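/- **Setting.** Let $\mathbf E$ and $\mathbf A$ be sets of element labels and attribute names (with an effective coding), let $\mathtt S$ be the text symbol and let $root\in\mathbf E$. A *path* is a sequence $l_1.\cdots.l_n$ $(n\ge 1)$ of labels with $l_1=root$ and $l_1,\dots,l_{n-1}\in\mathbf E$; $Last(l_1.\cdots.l_n)=l_n$, $Parnt(l_1.\cdots.l_n)=l_1.\cdots.l_{n-1}$, and $p\cap q$ is the maximal common prefix. Fix a finite prefix-closed set $P$ of paths that is label consistent: if the last label of $l'\in P$ occurs in $l\in P$, then $l'$ is the prefix of $l$ ending there. For $q \in P$, $Anc(q)$ is the set of strict prefixes of $q$ and $Att(q)=\{u\in P: Parnt(u)=q,\ Last(u)\in\mathbf A\}$. An *XML tree* is a finite rooted labelled tree $T$, with root labelled $root$, in which only element nodes have children, each node has at most one attribute child for each $a\in\mathbf A$, and $val(v)$ is $v$ itself for an element node and a string for attribute and text nodes. $(T,P)$ is *consistent* if, for every node and its parent, their labels occur in this order (not necessarily adjacently) in some path of $P$. The *minimal extension* $T_P$ is obtained by adding null nodes (each with itself as value) so that every node whose label occurs in a path of $P$ lies on an instance of this path: missing intermediate nodes above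 a node of $T$ are filled by a chain of nulls of its own, and a branch of nulls is added below a node exactly where no child with the required label is present. $N(p)$ is the set of end nodes of instances of $p$ in $T_P$, and $Nodes(x,p)$ is the set of those that lie on an instance of $p$ through $x$. A *unary XFD* over $P$ is $r\to s$ with $r,s\in P$. $T$ *strongly satisfies* it if $r=s$, or for any two distinct instances of $s$ in $T_P$, at least one of whose end nodes is null or whose end nodes have different $val$, the nodes $x,y$ of these instances in $N(r\cap s)$ satisfy: $x\ne y$ if $Last(r)\in\mathbf E$; otherwise $Nodes(x,r)$ and $Nodes(y,r)$ contain no nulls and $val(Nodes(x,r))\cap val(Nodes(y,r))=\emptyset$. A set $\Sigma$ of unary XFDs over $P$ *implies* $r\to s$ if every XML tree $T$ with $(T,P)$ consistent that strongly satisfies $\Sigma$ strongly satisfies $r\to s$. **Algorithm 2** (input $\Sigma$ and $p\in P$). Start with $P^+=\{p,root\}$; if $Last(p)\in\mathbf E$ add $Anc(p)$; then add $Att(q)$ for all $q\in P^+$. Repeat until no more changes to $P^+$: choose an arbitrary unused $r\to s\in\Sigma$ such that some $p_1\in P^+$ has $r\cap s$ as a prefix and is a prefix of $r$ or of $s$,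 or $r\in P^+$, or $r\cap s=root$; mark it used and add $s$ to $P^+$; if $Last(s)\in\mathbf E$, add also $Anc(s)$ and $Att(q)$ for every $q\in\{s\}\cup Anc(s)$. **Theorem.** Let $\Sigma$ be a finite set of unary XFDs over $P$ and let $p\in P$ with $Last(p)\notin\mathbf E$. 1. Every run of Algorithm 2 uses each XFD at most once, hence makes at most $|\Sigma|$ iterations; it can be continued until it stops. Whatever choices are made, the set returned is exactly $P^+=\{q\in P:\ p\to q\text{ is implied by }\Sigma\}$. 2. Algorithm 2 has an implementation (an index listing, for every path, the XFDs and paths it triggers, followed by a worklist search) that returns the same set. If all paths of $P$ have at most $L$ labels, it takes at most $100\,(L+1)^2(|\Sigma|+|P|+1)$ elementary steps, including the search for usable XFDs, where $|\Sigma|$ and $|P|$ are the lengths of the input lists and accessing a table at a path $u$ costs $|u|+1$ steps ($|u|$ being the number of labels of $u$). If $P$ is listed without repetition and contains only prefixes of $p$ and of paths in $\Sigma$, it takes at most $200\,(L+1)^3(|\Sigma|+1)$ steps; so the time is linear in $|\Sigma|$. 3. Implication is decidable: a computable function decides, for $P,\Sigma,p$ as above and $q\in P$, whether $\Sigma$ implies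 $p\to q$. -/

import Mathlib

namespace XML

/-! ### Labels and paths -/

/-- Labels: element labels (`inl e`), attribute names (`inr (inl a)`), and the text symbol `S`
(`inr (inr ())`). -/
abbrev Label (E A : Type) : Type := E ⊕ A ⊕ Unit

/-- A path `l₁.⋯.lₙ`, written as the list of its labels. -/
abbrev Path (E A : Type) : Type := List (Label E A)

/-- A unary XFD `r → s`, written as the pair `(r, s)`. -/
abbrev UnaryXFD (E A : Type) : Type := Path E A × Path E A

section Paths

variable {E A : Type}

def isElem : Label E A → Bool
  | .inl _ => true
  | _ => false

def isAttr : Label E A → Bool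
  | .inr (.inl _) => true
  | _ => false

/-- `Last(p)` is an element label. -/
def lastIsElem (p : Path E A) : Bool := p.getLast?.any isElem

/-- `Last(p)` is an attribute name. -/
def lastIsAttr (p : Path E A) : Bool := p.getLast?.any isAttr

/-- The path consisting of the root label only. -/
def rootPath (A : Type) {E : Type} (rt : E) : Path E A := [.inl rt]

/-- `p ∩ q`, the maximal common prefix. -/
def inter [DecidableEq E] [DecidableEq A] : Path E A → Path E A → Path E A
  | a :: p, b :: q => if a = b then a :: inter p q else []
  | _, _ => []

/-- Label consistency of a set of paths: if the last label of `l'` occurs in `l`, then `l'` is the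
prefix of `l` that ends at this occurrence. -/
def LabelConsistent (P : List (Path E A)) : Prop :=
  ∀ l ∈ P, ∀ l' ∈ P, ∀ i, i < l.length → l'.getLast? = l[i]? → l.take (i + 1) = l'

/-- The finite sets of paths over which XFDs are stated. -/
structure IsPathSet (rt : E) (P : List (Path E A)) : Prop where
  head : ∀ p ∈ P, p.head? = some (.inl rt)
  inner : ∀ p ∈ P, ∀ l ∈ p.dropLast, isElem l = true
  prefixClosed : ∀ p ∈ P, ∀ u, u ≠ [] → u <+: p → u ∈ P
  consistent : LabelConsistent P

end Paths

/-! ### XML trees -/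

/-- The data of a tree `(V, lab, ele, att, val, v_r)`. The field `null` is the set of marked nulls
among the nodes; `str` gives the string value of attribute and text nodes. -/
structure TreeData (E A : Type) where
  V : Type
  null : Set V
  lab : V → Label E A
  ele : V → Option (List V)
  att : V → A → Option V
  str : V → String
  root : V

namespace TreeData

variable {E A : Type} (T : TreeData E A)

/-- `T.IsParent u v`: the node `v` is a subelement or an attribute of `u`. -/
def IsParent (u v : T.V) : Prop :=
  (∃ l, T.ele u = some l ∧ v ∈ l) ∨ ∃ a, T.att u a = some v

/-- `u` is a proper ancestor of `v`. -/
def IsAncestor : T.V → T.V → Prop := Relation.TransGen T.IsParent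

open Classical in
/-- `val`: element nodes and nulls have themselves as value, other nodes have a string. -/
noncomputable def val (v : T.V) : T.V ⊕ String :=
  if isElem (T.lab v) = true ∨ v ∈ T.null then .inl v else .inr (T.str v)

/-- `Paths(p)`: the path instances `v₁.⋯.vₙ` defined over `p`. -/
def Paths (p : Path E A) : Set (List T.V) :=
  {vs | vs.head? = some T.root ∧ vs.IsChain T.IsParent ∧ vs.map T.lab = p}

/-- `N(p)`: the final nodes of the path instances over `p`. -/
def N (p : Path E A) : Set T.V :=
  {v | ∃ vs ∈ T.Paths p, vs.getLast? = some v}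

/-- `Nodes(v, p)`: the final nodes of the path instances over `p` that pass through `v`. -/
def Nodes (v : T.V) (p : Path E A) : Set T.V :=
  {x | ∃ vs ∈ T.Paths p, vs.getLast? = some x ∧ v ∈ vs}

end TreeData

/-- An extended XML tree, that is, a finite XML tree some of whose nodes may be marked nulls. -/
structure ExtTree (E A : Type) (rt : E) extends TreeData E A where
  finite : Finite V
  lab_root : lab root = .inl rt
  ele_lab : ∀ v l, ele v = some l → isElem (lab v) = true
  ele_child : ∀ v l, ele v = some l → ∀ w ∈ l, isAttr (lab w) = false
  ele_nodup : ∀ v l, ele v = some l → l.Nodup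
  att_lab : ∀ v a w, att v a = some w → isElem (lab v) = true ∧ lab w = .inr (.inl a)
  root_top : ∀ u, ¬ toTreeData.IsParent u root
  parent_unique : ∀ u u' v, toTreeData.IsParent u v → toTreeData.IsParent u' v → u = u'
  reachable : ∀ v, Relation.ReflTransGen toTreeData.IsParent root v

section Semantics

variable {E A : Type} {rt : E}

/-- An XML tree: no node is a null. -/
def ExtTree.IsXMLTree (T : ExtTree E A rt) : Prop := T.null = ∅

/-- `(T, P)` is consistent. -/
def Consistent (T : ExtTree E A rt) (P : List (Path E A)) : Prop :=
  LabelConsistent P ∧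
  ∀ v₁ v₂, T.IsParent v₁ v₂ →
    ∃ l ∈ P, ∃ i j : ℕ, i < j ∧ l[i]? = some (T.lab v₁) ∧ l[j]? = some (T.lab v₂)

/-- `T'` is a minimal extension `T_P` of the XML tree `T` (it is determined up to the names of the
nulls). Missing intermediate nodes above a node of `T` are filled by a chain of nulls of its own,
and a missing branch is filled by nulls exactly where no branch with that label is present. -/
def IsMinimalExtension (P : List (Path E A)) (T T' : ExtTree E A rt) : Prop :=
  ∃ ι : T.V → T'.V, Function.Injective ι ∧
    -- the new nodes are the nulls, and the old nodes keep their data and their tree order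
    (∀ w, w ∈ T'.null ↔ w ∉ Set.range ι) ∧
    ι T.root = T'.root ∧
    (∀ v, T'.lab (ι v) = T.lab v) ∧
    (∀ v, T'.str (ι v) = T.str v) ∧
    (∀ u v, T'.IsAncestor (ι u) (ι v) ↔ T.IsAncestor u v) ∧
    -- every node whose label appears in a path of `P` lies on a path instance over this path
    (∀ p ∈ P, ∀ w, T'.lab w ∈ p → ∃ vs ∈ T'.Paths p, w ∈ vs) ∧
    -- nulls are added only on path instances over paths of `P`
    (∀ w ∈ T'.null, ∃ p ∈ P, ∃ vs ∈ T'.Paths p, w ∈ vs) ∧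
    -- a null inserted above a node of `T` is inserted for this node only
    (∀ w ∈ T'.null, ∀ c c', T'.IsParent w c → T'.IsParent w c' →
      (∃ v, Relation.ReflTransGen T'.IsParent c (ι v)) →
      (∃ v, Relation.ReflTransGen T'.IsParent c' (ι v)) → c = c') ∧
    -- a null with no node of `T` below it fills a label that is otherwise missing at its parent
    (∀ w ∈ T'.null, (∀ v, ¬ T'.IsAncestor w (ι v)) →
      ∀ u w', T'.IsParent u w → T'.IsParent u w' → T'.lab w' = T'.lab w → w' = w)

variable [DecidableEq E] [DecidableEq A]

/-- Strong satisfaction of the XFD `r → s`, evaluated in a minimal extension `T_P`. -/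
def StronglySatisfies (T : ExtTree E A rt) (r s : Path E A) : Prop :=
  r = s ∨
  ∀ vs ∈ T.Paths s, ∀ vs' ∈ T.Paths s, vs ≠ vs' →
    ∀ v v', vs.getLast? = some v → vs'.getLast? = some v' →
    ((v ∈ T.null ∧ v' ∈ T.null) ∨ (v ∉ T.null ∧ v' ∈ T.null) ∨ (v ∈ T.null ∧ v' ∉ T.null) ∨
      (v ∉ T.null ∧ v' ∉ T.null ∧ T.val v ≠ T.val v')) →
    ∃ x ∈ vs, ∃ y ∈ vs', x ∈ T.N (inter r s) ∧ y ∈ T.N (inter r s) ∧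
      if lastIsElem r = true then x ≠ y
      else (∀ z ∈ T.Nodes x r, z ∉ T.null) ∧ (∀ z ∈ T.Nodes y r, z ∉ T.null) ∧
        Disjoint (T.val '' T.Nodes x r) (T.val '' T.Nodes y r)

/-- The set `S` of XFDs over `P` implies the XFD `r → s` over `P`: every XML tree `T` with `(T, P)`
consistent that strongly satisfies all XFDs in `S` strongly satisfies `r → s`. -/
def Implies (rt : E) (P : List (Path E A)) (S : List (UnaryXFD E A)) (r s : Path E A) : Prop :=
  ∀ T T' : ExtTree E A rt, T.IsXMLTree → Consistent T P → IsMinimalExtension P T T' →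
    (∀ σ ∈ S, StronglySatisfies T' σ.1 σ.2) → StronglySatisfies T' r s

/-- The inputs: a finite set `P` of paths, a set `S` of unary XFDs over `P`, and a path `p` in `P`
whose last label is not an element label. -/
structure IsInput (rt : E) (P : List (Path E A)) (S : List (UnaryXFD E A)) (p : Path E A) :
    Prop where
  pathSet : IsPathSet rt P
  xfds : ∀ σ ∈ S, σ.1 ∈ P ∧ σ.2 ∈ P
  mem : p ∈ P
  last : lastIsElem p = false

end Semantics

/-! ### The closure algorithm -/

section Algorithm

variable {E A : Type} [DecidableEq E] [DecidableEq A]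

/-- `Anc(p)`: the strict prefixes of `p`. -/
def Anc (p : Path E A) : Finset (Path E A) :=
  (p.inits.filter fun u => u ≠ [] ∧ u ≠ p).toFinset

/-- `Att(p)`: the paths `q` with `p = Parnt(q)` and `Last(q)` an attribute name. -/
def Att (P : List (Path E A)) (p : Path E A) : Finset (Path E A) :=
  (P.filter fun q => q.dropLast = p ∧ lastIsAttr q = true).toFinset

/-- Initialisation: `P⁺ = {p, root}`; if `Last(p) ∈ E`, add `Anc(p)`; add `Att(q)` for all `q ∈ P⁺`. -/
def initClosure (rt : E) (P : List (Path E A)) (p : Path E A) : Finset (Path E A) :=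
  let C₁ : Finset (Path E A) := {p, rootPath A rt}
  let C₂ := if lastIsElem p = true then C₁ ∪ Anc p else C₁
  C₂ ∪ C₂.biUnion (Att P)

/-- The test whether `r → s` may be used. -/
def Applicable (rt : E) (C : Finset (Path E A)) (r s : Path E A) : Prop :=
  (∃ p₁ ∈ C, inter r s <+: p₁ ∧ (p₁ <+: r ∨ p₁ <+: s)) ∨ r ∈ C ∨ inter r s = rootPath A rt

/-- The update by an XFD `r → s`: add `s`; if `Last(s) ∈ E`, add `Anc(s)`, and `Att(q)` for `s`
and for all `q ∈ Anc(s)`. -/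
def extend (P : List (Path E A)) (C : Finset (Path E A)) (s : Path E A) : Finset (Path E A) :=
  if lastIsElem s = true then
    C ∪ {s} ∪ Anc s ∪ ({s} ∪ Anc s).biUnion (Att P)
  else C ∪ {s}

/-- A state of the algorithm: the current `P⁺` and the XFDs not used so far. -/
structure State (E A : Type) where
  closure : Finset (Path E A)
  unused : Finset (UnaryXFD E A)

/-- The state before the loop is entered. -/
def initState (rt : E) (P : List (Path E A)) (S : List (UnaryXFD E A)) (p : Path E A) :
    State E A :=
  ⟨initClosure rt P p, S.toFinset⟩

/-- One iteration of the loop uses an arbitrary unused XFD that passes the test. -/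
def Iteration (rt : E) (P : List (Path E A)) (c c' : State E A) : Prop :=
  ∃ r s, (r, s) ∈ c.unused ∧ Applicable rt c.closure r s ∧
    c' = ⟨extend P c.closure s, c.unused.erase (r, s)⟩

/-- `Run rt P n c c'`: some sequence of `n` iterations leads from `c` to `c'`. -/
inductive Run (rt : E) (P : List (Path E A)) : ℕ → State E A → State E A → Prop
  | refl (c : State E A) : Run rt P 0 c c
  | step {n : ℕ} {c c' c'' : State E A} :
      Run rt P n c c' → Iteration rt P c' c'' → Run rt P (n + 1) c c''

/-- The loop may stop: no further iteration changes `P⁺`. -/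
def Final (rt : E) (P : List (Path E A)) (c : State E A) : Prop :=
  ∀ c', Iteration rt P c c' → c'.closure = c.closure

end Algorithm

/-! ### An implementation with a step count

The search for an unused XFD that passes the test is part of the cost. Elementary steps are
operations on single labels and list cells; a table indexed by paths is read and written at the cost
of walking along the path. -/

/-- A value together with the number of elementary steps spent on computing it. -/
structure Timed (α : Type) where
  val : α
  time : ℕ

instance : Monad Timed where
  pure a := ⟨a, 0⟩
  bind x f := ⟨(f x.val).val, x.time + (f x.val).time⟩

/-- Spend `n` steps. -/
def spend (n : ℕ) : Timed Unit := ⟨(), n⟩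

/-- Run a loop body on the members of a list, one step for each of them in addition. -/
def forEach {α β : Type} (body : α → β → Timed β) : List α → β → Timed β
  | [], b => do
      spend 1
      pure b
  | a :: l, b => do
      spend 1
      let b' ← body a b
      forEach body l b'

section Implementation

variable {E A : Type} [DecidableEq E] [DecidableEq A]

/-- A table indexed by paths. -/
abbrev Table (E A β : Type) : Type := Path E A → β

def readTable {β : Type} (t : Table E A β) (u : Path E A) : Timed β :=
  ⟨t u, u.length + 1⟩

def writeTable {β : Type} (t : Table E A β) (u : Path E A) (b : β) : Timed (Table E A β) :=
  ⟨Function.update t u b, u.length + 1⟩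

/-- The table `next` lists, for each path `u`, paths that enter `P⁺` as soon as `u` does. -/
abbrev Next (E A : Type) : Type := Table E A (List (Path E A))

/-- Record that `w` enters `P⁺` as soon as `u` does. -/
def addLink (u w : Path E A) (t : Next E A) : Timed (Next E A) := do
  let l ← readTable t u
  writeTable t u (w :: l)

/-- Index a path: its strict prefixes if it ends in an element, its parent if in an attribute. -/
def indexPath (u : Path E A) (t : Next E A) : Timed (Next E A) := do
  spend (u.length + 1)
  if lastIsElem u = true then
    forEach (fun w t => do
      spend (w.length + 1)
      if w ≠ [] ∧ w ≠ u then addLink u w t else pure t) u.inits t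
  else if lastIsAttr u = true then addLink u.dropLast u t
  else pure t

/-- Index an XFD `r → s` at all paths that make it pass the test. -/
def indexXFD (σ : UnaryXFD E A) (t : Next E A) : Timed (Next E A) := do
  spend (σ.1.length + σ.2.length + 1)
  let k := (inter σ.1 σ.2).length
  let body := fun (w : Path E A) (t : Next E A) => do
    spend (w.length + 1)
    if k ≤ w.length then addLink w σ.2 t else pure t
  let t ← forEach body σ.1.inits t
  forEach body σ.2.inits t

/-- The current `P⁺`, as a table and as a list, and the members still to be processed. -/
structure Store (E A : Type) where
  known : Table E A Bool
  found : List (Path E A)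
  agenda : List (Path E A)

/-- Put `u` into `P⁺` unless it is there already. -/
def insertPath (u : Path E A) (c : Store E A) : Timed (Store E A) := do
  let b ← readTable c.known u
  if b = true then pure c
  else do
    let known ← writeTable c.known u true
    spend 2
    pure ⟨known, u :: c.found, u :: c.agenda⟩

/-- The main loop, with a bound on the number of rounds. -/
def mainLoop (t : Next E A) : ℕ → Store E A → Timed (Store E A)
  | 0, c => do
      spend 1
      pure c
  | n + 1, c => do
      spend 1
      match c.agenda with
      | [] => pure c
      | u :: rest => do
          let l ← readTable t u
          let c' ← forEach insertPath l { c with agenda := rest }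
          mainLoop t n c'

/-- The implementation of the algorithm; it returns `P⁺` as a list. -/
def computeClosure (rt : E) (P : List (Path E A)) (S : List (UnaryXFD E A)) (p : Path E A) :
    Timed (List (Path E A)) := do
  let t ← forEach indexPath P (fun _ => [])
  let t ← forEach indexXFD S t
  let c ← forEach insertPath [p, rootPath A rt] ⟨fun _ => false, [], []⟩
  spend P.length
  let c ← mainLoop t P.length c
  pure c.found

end Implementation

end XML

/-!
For a single left-hand side `p` that does not end in an element label, the implied right-hand sides
are generated by rules with one premise (`Derives`): an element path gives its prefixes and its
attributes, and an XFD `r → s` gives `s` as soon as a path between `r ∩ s` and `r` or `s` is present.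
A set of paths is closed (`RuleClosed`) if it contains `p` and `root` and is closed under these rules.
Everything follows from the fact that `{q ∈ P | p → q is implied}` is the least closed set.

*Soundness* (`ruleClosed_implies`): this set is closed. In a tree in which every node lies on
instances of all paths containing its label, strong satisfaction of `r → s` says that, whenever two
instances of `s` differ, all instances of `r` that meet them at `r ∩ s` are separated
(`stronglySatisfies_iff`). In this form XFDs compose, since common prefixes obey the ultrametric
inequality (`Satisfies.trans`), and the remaining rules come from the uniqueness of ancestors and
attributes. Of the minimal extension, only the saturation property is needed.

*Completeness* (`RuleClosed.mem_of_implies`): let `X` be closed and `q ∉ X`. The two-copy tree of `X`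
has one instance of each path all of whose prefixes lie in `X`, and two instances of every other path,
in two disjoint copies; attribute and text nodes of the two copies have the same value exactly for
paths in `X`. This tree has no missing nodes, so that it is its own minimal extension. It satisfies all
the XFDs but not `p → q`.

Both the nondeterministic algorithm (`Reached.ruleClosed`, `Reached.least`) and its implementation
(`RuleClosed.computeClosure`) produce a closed set that is contained in all closed sets. The worklist
search processes each path at most once, so that its cost is bounded by the number of links in the
index (`StoreInv.time_mainLoop_le`, `linkCount_linkTable_le`). Finally, `p → q` is implied if and only
if `q` lies in all closed sublists of `P`, a bounded quantification over primitive recursive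
conditions (`implies_iff_forall_sublists`).
-/

namespace XML

/-! ### Prefixes and the maximal common prefix -/

section Inter

variable {E A : Type} [DecidableEq E] [DecidableEq A]

theorem inter_prefix_left : ∀ p q : Path E A, inter p q <+: p
  | [], _ => by simp [inter]
  | _ :: _, [] => by simp [inter]
  | a :: p, b :: q => by
    unfold inter
    split_ifs
    · exact (List.prefix_cons_inj a).2 (inter_prefix_left p q)
    · exact List.nil_prefix

theorem inter_prefix_right : ∀ p q : Path E A, inter p q <+: q
  | [], _ => by simp [inter]
  | _ :: _, [] => by simp [inter]
  | a :: p, b :: q => by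
    unfold inter
    split_ifs with h
    · subst h
      exact (List.prefix_cons_inj a).2 (inter_prefix_right p q)
    · exact List.nil_prefix

theorem prefix_inter : ∀ {w p q : Path E A}, w <+: p → w <+: q → w <+: inter p q
  | [], _, _, _, _ => List.nil_prefix
  | a :: w, p, q, hp, hq => by
    obtain ⟨p', rfl⟩ := hp
    obtain ⟨q', rfl⟩ := hq
    simp only [List.cons_append, inter, if_true]
    exact (List.prefix_cons_inj a).2
      (prefix_inter (List.prefix_append w p') (List.prefix_append w q'))

theorem length_inter_le_left (p q : Path E A) : (inter p q).length ≤ p.length :=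
  (inter_prefix_left p q).length_le

theorem length_inter_le_right (p q : Path E A) : (inter p q).length ≤ q.length :=
  (inter_prefix_right p q).length_le

theorem take_length_inter_left (p q : Path E A) : p.take (inter p q).length = inter p q :=
  (List.prefix_iff_eq_take.1 (inter_prefix_left p q)).symm

theorem take_length_inter_right (p q : Path E A) : q.take (inter p q).length = inter p q :=
  (List.prefix_iff_eq_take.1 (inter_prefix_right p q)).symm

theorem inter_eq_left {p q : Path E A} (h : p <+: q) : inter p q = p :=
  (inter_prefix_left p q).eq_of_length_le (prefix_inter List.prefix_rfl h).length_le

theorem inter_eq_right {p q : Path E A} (h : q <+: p) : inter p q = q :=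
  (inter_prefix_right p q).eq_of_length_le (prefix_inter h List.prefix_rfl).length_le

/-- The common prefixes of three paths satisfy the ultrametric inequality. -/
theorem min_length_inter_le (p r s : Path E A) :
    min (inter p r).length (inter r s).length ≤ (inter p s).length := by
  rcases le_total (inter p r).length (inter r s).length with h | h
  · rw [min_eq_left h]
    refine (prefix_inter (inter_prefix_left p r) ?_).length_le
    exact (List.prefix_of_prefix_length_le (inter_prefix_right p r) (inter_prefix_left r s) h).trans
      (inter_prefix_right r s)
  · rw [min_eq_right h]
    refine (prefix_inter ?_ (inter_prefix_right r s)).length_le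
    exact (List.prefix_of_prefix_length_le (inter_prefix_left r s) (inter_prefix_right p r) h).trans
      (inter_prefix_left p r)

end Inter

section PathSet

variable {E A : Type} {rt : E} {P : List (Path E A)}

theorem IsPathSet.ne_nil (hP : IsPathSet rt P) {u : Path E A} (hu : u ∈ P) : u ≠ [] := by
  rintro rfl
  simpa using hP.head _ hu

theorem IsPathSet.length_pos (hP : IsPathSet rt P) {u : Path E A} (hu : u ∈ P) : 0 < u.length :=
  List.length_pos_iff.2 (hP.ne_nil hu)

theorem IsPathSet.rootPath_prefix (hP : IsPathSet rt P) {u : Path E A} (hu : u ∈ P) :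
    rootPath A rt <+: u := by
  have h := hP.head u hu
  cases u with
  | nil => simp at h
  | cons a u =>
    simp only [List.head?_cons, Option.some.injEq] at h
    subst h
    exact ⟨u, rfl⟩

theorem IsPathSet.rootPath_mem (hP : IsPathSet rt P) {u : Path E A} (hu : u ∈ P) :
    rootPath A rt ∈ P :=
  hP.prefixClosed u hu _ (by simp [rootPath]) (hP.rootPath_prefix hu)

/-- A proper nonempty prefix of a path ends in an element label. -/
theorem IsPathSet.lastIsElem_of_prefix (hP : IsPathSet rt P) {u w : Path E A} (hu : u ∈ P)
    (hw : w <+: u) (hw0 : w ≠ []) (hne : w ≠ u) : lastIsElem w = true := by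
  have hlt : w.length < u.length :=
    lt_of_le_of_ne hw.length_le fun h => hne (hw.eq_of_length h)
  have hw' : w <+: u.dropLast := by
    refine List.prefix_of_prefix_length_le hw (List.dropLast_prefix u) ?_
    rw [List.length_dropLast]
    omega
  unfold lastIsElem
  rw [List.getLast?_eq_getLast_of_ne_nil hw0]
  exact hP.inner u hu _ (hw'.subset (List.getLast_mem hw0))

theorem IsPathSet.lastIsElem_dropLast (hP : IsPathSet rt P) {u : Path E A} (hu : u ∈ P)
    (h0 : u.dropLast ≠ []) : lastIsElem u.dropLast = true := by
  refine hP.lastIsElem_of_prefix hu (List.dropLast_prefix u) h0 fun he => ?_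
  have h1 := congrArg List.length he
  have h2 := hP.length_pos hu
  rw [List.length_dropLast] at h1
  omega

theorem not_lastIsElem_of_lastIsAttr {u : Path E A} (h : lastIsAttr u = true) :
    lastIsElem u = false := by
  unfold lastIsAttr at h
  unfold lastIsElem
  cases hl : u.getLast? with
  | none => rfl
  | some a => rcases a with e | a | t <;> simp [hl, isElem, isAttr] at h ⊢

/-- The last label of a path determines the path. -/
theorem IsPathSet.prefix_of_getLast?_mem (hP : IsPathSet rt P) {u w : Path E A} (hu : u ∈ P)
    (hw : w ∈ P) {a : Label E A} (ha : w.getLast? = some a) (hau : a ∈ u) : w <+: u := by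
  obtain ⟨i, hi, rfl⟩ := List.mem_iff_getElem.1 hau
  rw [← hP.consistent u hu w hw i hi (by rw [ha, List.getElem?_eq_getElem hi])]
  exact List.take_prefix _ _

variable [DecidableEq E] [DecidableEq A]

theorem IsPathSet.rootPath_prefix_inter (hP : IsPathSet rt P) {u w : Path E A} (hu : u ∈ P)
    (hw : w ∈ P) : rootPath A rt <+: inter u w :=
  prefix_inter (hP.rootPath_prefix hu) (hP.rootPath_prefix hw)

theorem IsPathSet.inter_ne_nil (hP : IsPathSet rt P) {u w : Path E A} (hu : u ∈ P)
    (hw : w ∈ P) : inter u w ≠ [] := by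
  intro h
  have := (hP.rootPath_prefix_inter hu hw).length_le
  simp [h, rootPath] at this

/-! ### The rules behind the algorithm -/

/-- `Derives S w u`: as soon as `w` is in `P⁺`, so is `u`, either as a prefix of the element path
`w`, or as an attribute of `w`, or by an XFD of `S` that `w` makes applicable. All three rules have
a single premise, so that `P⁺` consists of the paths reachable from `p` and `root`. -/
def Derives (S : List (UnaryXFD E A)) (w u : Path E A) : Prop :=
  (lastIsElem w = true ∧ u <+: w) ∨ (lastIsAttr u = true ∧ u.dropLast = w) ∨
    ∃ σ ∈ S, σ.2 = u ∧ inter σ.1 σ.2 <+: w ∧ (w <+: σ.1 ∨ w <+: σ.2)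

/-- `X` contains `p` and `root` and is closed under the rules. -/
structure RuleClosed (rt : E) (P : List (Path E A)) (S : List (UnaryXFD E A)) (p : Path E A)
    (X : Set (Path E A)) : Prop where
  start : p ∈ X
  root : rootPath A rt ∈ X
  step : ∀ w ∈ X, ∀ u ∈ P, Derives S w u → u ∈ X

end PathSet

/-! ### Path instances in a tree -/

section Instances

variable {E A : Type} {rt : E}

/-- In a tree, the path from the root to a node is unique. -/
theorem ExtTree.take_eq_take (T : ExtTree E A rt) {vs vs' : List T.V}
    (h0 : vs.head? = some T.root) (hc : vs.IsChain T.IsParent)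
    (h0' : vs'.head? = some T.root) (hc' : vs'.IsChain T.IsParent) :
    ∀ {i j : ℕ} {x : T.V}, vs[i]? = some x → vs'[j]? = some x →
      i = j ∧ vs.take (i + 1) = vs'.take (j + 1) := by
  have hpar : ∀ {ws : List T.V}, ws.IsChain T.IsParent → ∀ {i x}, ws[i + 1]? = some x →
      ∃ y, ws[i]? = some y ∧ T.IsParent y x := by
    intro ws hws i x hx
    obtain ⟨hi, rfl⟩ := List.getElem?_eq_some_iff.1 hx
    exact ⟨ws[i], List.getElem?_eq_getElem (by omega), List.isChain_iff_getElem.1 hws i hi⟩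
  intro i
  induction i with
  | zero =>
    intro j x hi hj
    have hx : x = T.root := by
      rw [← List.head?_eq_getElem?, h0] at hi
      exact (Option.some.inj hi).symm
    cases j with
    | zero =>
      refine ⟨rfl, ?_⟩
      rw [List.take_add_one, List.take_add_one, hi, hj]
      simp
    | succ j =>
      obtain ⟨y, -, hy⟩ := hpar hc' hj
      exact absurd (hx ▸ hy) (T.root_top y)
  | succ i ih =>
    intro j x hi hj
    obtain ⟨y, hyi, hy⟩ := hpar hc hi
    cases j with
    | zero =>
      have hx : x = T.root := by
        rw [← List.head?_eq_getElem?, h0'] at hj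
        exact (Option.some.inj hj).symm
      exact absurd (hx ▸ hy) (T.root_top y)
    | succ j =>
      obtain ⟨y', hyj, hy'⟩ := hpar hc' hj
      obtain rfl := T.parent_unique _ _ _ hy hy'
      obtain ⟨rfl, ht⟩ := ih hyi hyj
      refine ⟨rfl, ?_⟩
      rw [List.take_add_one, ht, List.take_add_one (i := i + 1), hi, hj]

variable {T : ExtTree E A rt}

theorem length_of_mem_paths {vs : List T.V} {u : Path E A} (h : vs ∈ T.Paths u) :
    vs.length = u.length := by
  rw [← h.2.2, List.length_map]

theorem eq_of_getLast?_eq {vs vs' : List T.V} {u u' : Path E A} (h : vs ∈ T.Paths u)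
    (h' : vs' ∈ T.Paths u') {x : T.V} (hx : vs.getLast? = some x) (hx' : vs'.getLast? = some x) :
    vs = vs' := by
  have h1 : vs ≠ [] := by rintro rfl; simp at hx
  have h2 : vs' ≠ [] := by rintro rfl; simp at hx'
  have h1 := List.length_pos_iff.2 h1
  have h2 := List.length_pos_iff.2 h2
  rw [List.getLast?_eq_getElem?] at hx hx'
  obtain ⟨-, ht⟩ := T.take_eq_take h.1 h.2.1 h'.1 h'.2.1 hx hx'
  rwa [List.take_of_length_le (by omega), List.take_of_length_le (by omega)] at ht

theorem take_mem_paths {vs : List T.V} {u : Path E A} (h : vs ∈ T.Paths u) {n : ℕ} (hn : 0 < n) :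
    vs.take n ∈ T.Paths (u.take n) := by
  refine ⟨?_, h.2.1.take n, by rw [List.map_take, h.2.2]⟩
  rw [List.head?_take, if_neg hn.ne', h.1]

theorem getLast?_take_of_lt {α : Type} {l : List α} {n : ℕ} (hn : 0 < n) (h : n ≤ l.length) :
    (l.take n).getLast? = l[n - 1]? := by
  rw [List.getLast?_eq_getElem?, List.length_take, min_eq_left h, List.getElem?_take_of_lt (by omega)]

/-- A node of `vs` in `N(w)`, where `w` is a prefix of the path of `vs`, is the one at depth `|w|`. -/
theorem getElem?_of_mem_N {vs : List T.V} {u w : Path E A} (h : vs ∈ T.Paths u) {x : T.V}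
    (hx : x ∈ vs) (hN : x ∈ T.N w) : vs[w.length - 1]? = some x := by
  obtain ⟨ws, hws, hl⟩ := hN
  obtain ⟨i, hi⟩ := List.mem_iff_getElem?.1 hx
  rw [List.getLast?_eq_getElem?] at hl
  obtain ⟨rfl, -⟩ := T.take_eq_take h.1 h.2.1 hws.1 hws.2.1 hi hl
  rwa [length_of_mem_paths hws] at hi

theorem mem_N_of_getElem? {vs : List T.V} {u w : Path E A} (h : vs ∈ T.Paths u) (hw0 : w ≠ [])
    (hw : w <+: u) {x : T.V} (hx : vs[w.length - 1]? = some x) : x ∈ T.N w := by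
  have hpos := List.length_pos_iff.2 hw0
  refine ⟨vs.take w.length, ?_, ?_⟩
  · have := take_mem_paths h hpos
    rwa [← List.prefix_iff_eq_take.1 hw] at this
  · rw [getLast?_take_of_lt hpos (by rw [length_of_mem_paths h]; exact hw.length_le), hx]

/-- Instances that share the node at depth `n` share everything above it. -/
theorem take_eq_take_of_getElem? {vs zs : List T.V} {u r : Path E A} (h : vs ∈ T.Paths u)
    (hz : zs ∈ T.Paths r) {n : ℕ} (hn : 0 < n) {x : T.V} (hx : vs[n - 1]? = some x)
    (hxz : zs[n - 1]? = some x) : zs.take n = vs.take n := by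
  have := (T.take_eq_take hz.1 hz.2.1 h.1 h.2.1 hxz hx).2
  rwa [Nat.sub_add_cancel hn] at this

theorem getElem?_eq_of_take_eq {α : Type} {l l' : List α} {n : ℕ} (hn : 0 < n)
    (h : l.take n = l'.take n) : l[n - 1]? = l'[n - 1]? := by
  have h' := congrArg (fun l => l[n - 1]?) h
  simpa [List.getElem?_take, show n - 1 < n by omega] using h'

/-! ### Strong satisfaction in terms of path instances -/

/-- Every node whose label occurs in a path of `P` lies on an instance of this path. -/
def Saturated (P : List (Path E A)) (T : ExtTree E A rt) : Prop :=
  ∀ p ∈ P, ∀ w, T.lab w ∈ p → ∃ vs ∈ T.Paths p, w ∈ vs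

theorem IsMinimalExtension.saturated {P : List (Path E A)} {T T' : ExtTree E A rt}
    (h : IsMinimalExtension P T T') : Saturated P T' := by
  obtain ⟨ι, -, -, -, -, -, -, h, -⟩ := h
  exact h

/-- In a saturated tree, an initial piece of a path instance can be continued along any path of `P`
that starts with the same labels. -/
theorem Saturated.exists_extension {P : List (Path E A)} (hT : Saturated P T) {vs : List T.V}
    {u r : Path E A} (h : vs ∈ T.Paths u) (hr : r ∈ P) {n : ℕ} (hn : 0 < n) (hnu : n ≤ u.length)
    (hur : u.take n <+: r) : ∃ zs ∈ T.Paths r, zs.take n = vs.take n := by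
  have hlt : n - 1 < vs.length := by rw [length_of_mem_paths h]; omega
  have hlab : T.lab vs[n - 1] = u[n - 1] := by simp [← h.2.2]
  obtain ⟨zs, hz, hm⟩ := hT r hr vs[n - 1] (by
    rw [hlab]
    refine hur.subset (List.mem_take_iff_getElem.2 ⟨n - 1, by omega, rfl⟩))
  refine ⟨zs, hz, ?_⟩
  have hN : vs[n - 1] ∈ T.N (u.take n) :=
    ⟨vs.take n, take_mem_paths h hn, by
      rw [getLast?_take_of_lt hn (by rw [length_of_mem_paths h]; exact hnu),
        List.getElem?_eq_getElem hlt]⟩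
  have hlen : (u.take n).length = n := by rw [List.length_take, min_eq_left hnu]
  have := getElem?_of_mem_N hz hm hN
  rw [hlen] at this
  exact take_eq_take_of_getElem? h hz hn (List.getElem?_eq_getElem hlt) this

/-- Two distinct instances of a path, at least one of whose end nodes is null or whose end nodes have
different values. -/
def Differ (T : ExtTree E A rt) (vs vs' : List T.V) : Prop :=
  vs ≠ vs' ∧ ∃ v v', vs.getLast? = some v ∧ vs'.getLast? = some v' ∧
    (v ∈ T.null ∨ v' ∈ T.null ∨ T.val v ≠ T.val v')

/-- The difference that the left-hand side `r` of an XFD has to show: the instances are distinct if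
`Last(r)` is an element label, and otherwise their end nodes are not null and have different
values. -/
def Separated (T : ExtTree E A rt) (r : Path E A) (zs zs' : List T.V) : Prop :=
  if lastIsElem r = true then zs ≠ zs'
  else ∀ z z', zs.getLast? = some z → zs'.getLast? = some z' →
    z ∉ T.null ∧ z' ∉ T.null ∧ T.val z ≠ T.val z'

theorem exists_getLast? {vs : List T.V} {u : Path E A} (h : vs ∈ T.Paths u) :
    ∃ v, vs.getLast? = some v := by
  have : vs ≠ [] := by rintro rfl; simpa using h.1
  exact ⟨_, List.getLast?_eq_getLast_of_ne_nil this⟩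

theorem isElem_lab_of_getLast? {vs : List T.V} {u : Path E A} (h : vs ∈ T.Paths u) {v : T.V}
    (hv : vs.getLast? = some v) : isElem (T.lab v) = lastIsElem u := by
  rw [lastIsElem, ← h.2.2, List.getLast?_map, hv]
  rfl

theorem val_eq_inl {v : T.V} (h : isElem (T.lab v) = true) : T.val v = .inl v := by
  rw [TreeData.val, if_pos (Or.inl h)]

theorem Separated.differ {r : Path E A} {zs zs' : List T.V} (hz : zs ∈ T.Paths r)
    (hz' : zs' ∈ T.Paths r) (h : Separated T r zs zs') : Differ T zs zs' := by
  obtain ⟨z, hzl⟩ := exists_getLast? hz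
  obtain ⟨z', hzl'⟩ := exists_getLast? hz'
  unfold Separated at h
  split_ifs at h with hr
  · refine ⟨h, z, z', hzl, hzl', Or.inr (Or.inr fun he => h ?_)⟩
    rw [val_eq_inl (by rw [isElem_lab_of_getLast? hz hzl, hr]),
      val_eq_inl (by rw [isElem_lab_of_getLast? hz' hzl', hr])] at he
    obtain rfl := Sum.inl.inj he
    exact eq_of_getLast?_eq hz hz' hzl hzl'
  · obtain ⟨-, -, hne⟩ := h z z' hzl hzl'
    refine ⟨?_, z, z', hzl, hzl', Or.inr (Or.inr hne)⟩
    rintro rfl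
    rw [hzl] at hzl'
    exact hne (by rw [Option.some.inj hzl'])

theorem Separated.ne {r : Path E A} {zs zs' : List T.V} (hz : zs ∈ T.Paths r)
    (hz' : zs' ∈ T.Paths r) (h : Separated T r zs zs') : zs ≠ zs' :=
  (h.differ hz hz').1

variable [DecidableEq E] [DecidableEq A]

/-- Strong satisfaction of `r → s` without the exception for `r = s`, in a form symmetric in the
continuations to `r`: whenever two instances of `s` differ, all instances of `r` that meet them at
`r ∩ s` are separated. -/
def Satisfies (T : ExtTree E A rt) (r s : Path E A) : Prop :=
  ∀ vs ∈ T.Paths s, ∀ vs' ∈ T.Paths s, Differ T vs vs' →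
    ∀ zs ∈ T.Paths r, ∀ zs' ∈ T.Paths r, zs.take (inter r s).length = vs.take (inter r s).length →
      zs'.take (inter r s).length = vs'.take (inter r s).length → Separated T r zs zs'

theorem stronglySatisfies_iff {P : List (Path E A)} (hP : IsPathSet rt P) (hT : Saturated P T)
    {r s : Path E A} (hr : r ∈ P) (hs : s ∈ P) :
    StronglySatisfies T r s ↔ r = s ∨ Satisfies T r s := by
  have hk : 0 < (inter r s).length := List.length_pos_iff.2 (hP.inter_ne_nil hr hs)
  have hpass : ∀ {vs zs : List T.V} {x : T.V}, vs ∈ T.Paths s → zs ∈ T.Paths r →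
      vs[(inter r s).length - 1]? = some x → x ∈ zs →
      zs.take (inter r s).length = vs.take (inter r s).length := by
    intro vs zs x hvs hzs hx hxz
    exact take_eq_take_of_getElem? hvs hzs hk hx
      (getElem?_of_mem_N hzs hxz (mem_N_of_getElem? hvs (hP.inter_ne_nil hr hs)
        (inter_prefix_right r s) hx))
  unfold StronglySatisfies
  refine or_congr_right ⟨?_, ?_⟩
  · intro h vs hvs vs' hvs' ⟨hne, v, v', hv, hv', hd⟩ zs hzs zs' hzs' hm hm'
    obtain ⟨x, hx, y, hy, hxN, hyN, hxy⟩ := h vs hvs vs' hvs' hne v v' hv hv' (by tauto)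
    have hx' := getElem?_of_mem_N hvs hx hxN
    have hy' := getElem?_of_mem_N hvs' hy hyN
    rw [← getElem?_eq_of_take_eq hk hm] at hx'
    rw [← getElem?_eq_of_take_eq hk hm'] at hy'
    unfold Separated
    split_ifs at hxy ⊢
    · rintro rfl
      rw [hx'] at hy'
      exact hxy (Option.some.inj hy')
    · intro z z' hz hz'
      have h1 : z ∈ T.Nodes x r := ⟨zs, hzs, hz, List.mem_of_getElem? hx'⟩
      have h2 : z' ∈ T.Nodes y r := ⟨zs', hzs', hz', List.mem_of_getElem? hy'⟩
      exact ⟨hxy.1 z h1, hxy.2.1 z' h2,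
        hxy.2.2.ne_of_mem (Set.mem_image_of_mem _ h1) (Set.mem_image_of_mem _ h2)⟩
  · intro h vs hvs vs' hvs' hne v v' hv hv' hd
    have hD : Differ T vs vs' := ⟨hne, v, v', hv, hv', by tauto⟩
    have hget : ∀ {ws : List T.V}, ws ∈ T.Paths s →
        ∃ x, ws[(inter r s).length - 1]? = some x := by
      intro ws hws
      have : (inter r s).length - 1 < ws.length := by
        have := length_inter_le_right r s
        rw [length_of_mem_paths hws]
        omega
      exact ⟨_, List.getElem?_eq_getElem this⟩
    have hext : ∀ {ws : List T.V}, ws ∈ T.Paths s → ∃ zs ∈ T.Paths r,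
        zs.take (inter r s).length = ws.take (inter r s).length := fun hws =>
      hT.exists_extension hws hr hk (length_inter_le_right r s)
        (by rw [take_length_inter_right]; exact inter_prefix_left r s)
    obtain ⟨x, hx⟩ := hget hvs
    obtain ⟨y, hy⟩ := hget hvs'
    refine ⟨x, List.mem_of_getElem? hx, y, List.mem_of_getElem? hy,
      mem_N_of_getElem? hvs (hP.inter_ne_nil hr hs) (inter_prefix_right r s) hx,
      mem_N_of_getElem? hvs' (hP.inter_ne_nil hr hs) (inter_prefix_right r s) hy, ?_⟩
    have hsep := h vs hvs vs' hvs' hD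
    obtain ⟨zs, hzs, hm⟩ := hext hvs
    obtain ⟨zs', hzs', hm'⟩ := hext hvs'
    split_ifs with hel
    · rintro rfl
      have h1 := take_eq_take_of_getElem? hvs hvs' hk hx hy
      exact (hsep zs hzs zs hzs hm (by rw [hm, h1])).ne hzs hzs rfl
    · unfold Separated at hsep
      simp only [hel] at hsep
      obtain ⟨w, hw⟩ := exists_getLast? hzs
      obtain ⟨w', hw'⟩ := exists_getLast? hzs'
      refine ⟨?_, ?_, ?_⟩
      · rintro z ⟨ws, hws, hz, hxz⟩
        exact (hsep ws hws zs' hzs' (hpass hvs hws hx hxz) hm' z w' hz hw').1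
      · rintro z ⟨ws, hws, hz, hxz⟩
        exact (hsep zs hzs ws hws hm (hpass hvs' hws hy hxz) w z hw hz).2.1
      · rw [Set.disjoint_left]
        rintro _ ⟨z, ⟨ws, hws, hz, hxz⟩, rfl⟩ ⟨z', ⟨ws', hws', hz', hxz'⟩, he⟩
        exact (hsep ws hws ws' hws' (hpass hvs hws hx hxz) (hpass hvs' hws' hy hxz') z z' hz
          hz').2.2 he.symm

end Instances

/-! ### Soundness of the rules -/

section Soundness

variable {E A : Type} {rt : E} [DecidableEq E] [DecidableEq A] {T : ExtTree E A rt}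
  {P : List (Path E A)}

/-- Transitivity. By the ultrametric inequality, an instance of `p` and an instance of `s` that meet
at `p ∩ s` have a common instance of `r` that meets both of them as far as required. -/
theorem Satisfies.trans (hP : IsPathSet rt P) (hT : Saturated P T) {p r s : Path E A} (hp : p ∈ P)
    (hr : r ∈ P) (hs : s ∈ P) (h₁ : Satisfies T p r) (h₂ : Satisfies T r s) :
    Satisfies T p s := by
  have key : ∀ vs ∈ T.Paths s, ∀ ps ∈ T.Paths p,
      ps.take (inter p s).length = vs.take (inter p s).length →
      ∃ zs ∈ T.Paths r, zs.take (inter r s).length = vs.take (inter r s).length ∧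
        ps.take (inter p r).length = zs.take (inter p r).length := by
    intro vs hvs ps hps hm
    have hu := min_length_inter_le p r s
    have hcut : ∀ {n}, n ≤ (inter p s).length → ps.take n = vs.take n := by
      intro n hn
      have := congrArg (List.take n) hm
      simpa [List.take_take, min_eq_left hn] using this
    rcases le_total (inter p r).length (inter r s).length with h | h
    · rw [min_eq_left h] at hu
      obtain ⟨zs, hzs, hz⟩ := hT.exists_extension hvs hr
        (List.length_pos_iff.2 (hP.inter_ne_nil hr hs)) (length_inter_le_right r s)
        (by rw [take_length_inter_right]; exact inter_prefix_left r s)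
      refine ⟨zs, hzs, hz, ?_⟩
      rw [hcut hu]
      have := congrArg (List.take (inter p r).length) hz
      simpa [List.take_take, min_eq_left h] using this.symm
    · rw [min_eq_right h] at hu
      obtain ⟨zs, hzs, hz⟩ := hT.exists_extension hps hr
        (List.length_pos_iff.2 (hP.inter_ne_nil hp hr)) (length_inter_le_left p r)
        (by rw [take_length_inter_left]; exact inter_prefix_right p r)
      refine ⟨zs, hzs, ?_, hz.symm⟩
      rw [← hcut hu]
      have := congrArg (List.take (inter r s).length) hz
      simpa [List.take_take, min_eq_left h] using this
  intro vs hvs vs' hvs' hd ps hps ps' hps' hm hm'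
  obtain ⟨zs, hzs, h1, h2⟩ := key vs hvs ps hps hm
  obtain ⟨zs', hzs', h1', h2'⟩ := key vs' hvs' ps' hps' hm'
  exact h₁ zs hzs zs' hzs' ((h₂ vs hvs vs' hvs' hd zs hzs zs' hzs' h1 h1').differ hzs hzs')
    ps hps ps' hps' h2 h2'

/-- If `r → s` holds, then so does `w → s` for every element path `w` below `r ∩ s`: a common
instance of `w` would give a common instance of `r`. -/
theorem Satisfies.of_elem_of_inter_prefix (hP : IsPathSet rt P) (hT : Saturated P T)
    {r s w : Path E A} (hr : r ∈ P) (hs : s ∈ P) (h : Satisfies T r s)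
    (hw : lastIsElem w = true) (hrw : inter r s <+: w) : Satisfies T w s := by
  intro vs hvs vs' hvs' hd ws hws ws' hws' hm hm'
  rw [Separated, if_pos hw]
  rintro rfl
  have hle := (prefix_inter hrw (inter_prefix_right r s)).length_le
  have heq : vs'.take (inter r s).length = vs.take (inter r s).length := by
    have := congrArg (List.take (inter r s).length) (hm'.symm.trans hm)
    simpa [List.take_take, min_eq_left hle] using this
  obtain ⟨zs, hzs, hz⟩ := hT.exists_extension hvs hr
    (List.length_pos_iff.2 (hP.inter_ne_nil hr hs)) (length_inter_le_right r s)
    (by rw [take_length_inter_right]; exact inter_prefix_left r s)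
  exact (h vs hvs vs' hvs' hd zs hzs zs hzs hz (hz.trans heq.symm)).ne hzs hzs rfl

/-- There is only one instance of the path `root`. -/
theorem satisfies_rootPath (T : ExtTree E A rt) (p : Path E A) :
    Satisfies T p (rootPath A rt) := by
  intro vs hvs vs' hvs' hd
  refine absurd ?_ hd.1
  have h1 := length_of_mem_paths hvs
  have h2 := length_of_mem_paths hvs'
  obtain ⟨a, rfl⟩ := List.length_eq_one_iff.1 h1
  obtain ⟨b, rfl⟩ := List.length_eq_one_iff.1 h2
  have h3 := hvs.1
  have h4 := hvs'.1
  simp only [List.head?_cons, Option.some.injEq] at h3 h4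
  rw [h3, h4]

/-- A node determines its ancestors. -/
theorem satisfies_of_prefix {w u : Path E A} (hw : lastIsElem w = true) (hu : u <+: w) :
    Satisfies T w u := by
  intro vs hvs vs' hvs' hd zs hzs zs' hzs' hm hm'
  rw [Separated, if_pos hw]
  rintro rfl
  rw [inter_eq_right hu] at hm hm'
  rw [hm, List.take_of_length_le (length_of_mem_paths hvs).le,
    List.take_of_length_le (length_of_mem_paths hvs').le] at hm'
  exact hd.1 hm'

/-- A node determines its attributes. -/
theorem satisfies_of_attr {w u : Path E A} (hw : lastIsElem w = true) (hu : lastIsAttr u = true)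
    (hwu : u.dropLast = w) : Satisfies T w u := by
  intro vs hvs vs' hvs' hd zs hzs zs' hzs' hm hm'
  rw [Separated, if_pos hw]
  rintro rfl
  refine hd.1 ?_
  have hw0 : w ≠ [] := by rintro rfl; simp [lastIsElem] at hw
  have hpos := List.length_pos_iff.2 hw0
  have hwp : w <+: u := hwu ▸ List.dropLast_prefix u
  rw [inter_eq_left hwp] at hm hm'
  have hlen : u.length = w.length + 1 := by
    have := congrArg List.length hwu
    rw [List.length_dropLast] at this
    omega
  have hl := length_of_mem_paths hvs
  have hl' := length_of_mem_paths hvs'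
  have hi : w.length < vs.length := by omega
  have hi' : w.length < vs'.length := by omega
  have hp := List.isChain_iff_getElem.1 hvs.2.1 (w.length - 1) (by omega)
  have hp' := List.isChain_iff_getElem.1 hvs'.2.1 (w.length - 1) (by omega)
  have hpar : vs[w.length - 1] = vs'[w.length - 1] := by
    have := getElem?_eq_of_take_eq hpos (hm.symm.trans hm')
    rwa [List.getElem?_eq_getElem (by omega), List.getElem?_eq_getElem (by omega),
      Option.some.injEq] at this
  simp only [Nat.sub_add_cancel hpos] at hp hp'
  rw [← hpar] at hp'
  -- The last step of an instance of `u` is given by the attribute function.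
  have hatt : ∀ {ws : List T.V}, ws ∈ T.Paths u → ∀ (hj : w.length < ws.length) (x : T.V),
      T.IsParent x ws[w.length] → ∀ a, u.getLast? = some (.inr (.inl a)) →
      T.att x a = some ws[w.length] := by
    intro ws hws hj x hx a ha
    have hlab : T.lab ws[w.length] = .inr (.inl a) := by
      rw [List.getLast?_eq_getElem?, ← hws.2.2, List.getElem?_map, List.length_map,
        length_of_mem_paths hws, hlen, Nat.add_sub_cancel, List.getElem?_eq_getElem hj] at ha
      simpa using ha
    rcases hx with ⟨l, hl1, hl2⟩ | ⟨b, hb⟩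
    · have := T.ele_child _ _ hl1 _ hl2
      rw [hlab] at this
      simp [isAttr] at this
    · have := (T.att_lab _ _ _ hb).2
      rw [hlab] at this
      simp only [Sum.inr.injEq, Sum.inl.injEq] at this
      rwa [this]
  obtain ⟨a, ha⟩ : ∃ a, u.getLast? = some (.inr (.inl a)) := by
    unfold lastIsAttr at hu
    cases h : u.getLast? with
    | none => simp [h] at hu
    | some l =>
      rcases l with e | a | t
      · simp [h, isAttr] at hu
      · exact ⟨a, rfl⟩
      · simp [h, isAttr] at hu
  have h1 := hatt hvs hi _ hp a ha
  have h2 := hatt hvs' hi' _ hp' a ha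
  rw [h1] at h2
  have h3 := Option.some.inj h2
  have hfin : ∀ {ws : List T.V} (hj : w.length < ws.length), ws.length = w.length + 1 →
      ws = ws.take w.length ++ [ws[w.length]] := by
    intro ws hj hl
    rw [← List.take_succ_eq_append_getElem hj, List.take_of_length_le (by omega)]
  rw [hfin hi (by omega), hfin hi' (by omega), h3, ← hm, ← hm']

/-- The paths `q` with `p → q` implied are closed under the rules. -/
theorem ruleClosed_implies {S : List (UnaryXFD E A)} {p : Path E A} (h : IsInput rt P S p) :
    RuleClosed rt P S p {q | q ∈ P ∧ Implies rt P S p q} := by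
  have hP := h.pathSet
  refine ⟨⟨h.mem, fun _ _ _ _ _ _ => Or.inl rfl⟩, ⟨hP.rootPath_mem h.mem, ?_⟩, ?_⟩
  · intro T T' _ _ hT' _
    rw [stronglySatisfies_iff hP hT'.saturated h.mem (hP.rootPath_mem h.mem)]
    exact Or.inr (satisfies_rootPath T' p)
  · rintro w ⟨hw, hpw⟩ u hu hd
    refine ⟨hu, fun T T' hX hC hT' hS => ?_⟩
    have hsat := hT'.saturated
    have h₁ := hpw T T' hX hC hT' hS
    -- It suffices to find `w → u`, by transitivity.
    suffices h₂ : p = u ∨ w = u ∨ Satisfies T' w u by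
      rw [stronglySatisfies_iff hP hsat h.mem hw] at h₁
      rw [stronglySatisfies_iff hP hsat h.mem hu]
      rcases h₂ with h₂ | rfl | h₂
      · exact Or.inl h₂
      · exact h₁
      · rcases h₁ with rfl | h₁
        · exact Or.inr h₂
        · exact Or.inr (h₁.trans hP hsat h.mem hw hu h₂)
    rcases hd with ⟨hel, hpre⟩ | ⟨hat, hdl⟩ | ⟨⟨r, s⟩, hσ, rfl, hrw, hwrs⟩
    · exact Or.inr (Or.inr (satisfies_of_prefix hel hpre))
    · refine Or.inr (Or.inr (satisfies_of_attr ?_ hat hdl))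
      subst hdl
      exact hP.lastIsElem_dropLast hu (hP.ne_nil hw)
    · have hr := (h.xfds _ hσ).1
      have hs := (h.xfds _ hσ).2
      have h₃ := (stronglySatisfies_iff hP hsat hr hs).1 (hS _ hσ)
      simp only at hrw hwrs hr hs h₃ ⊢
      by_cases hwr : w = r
      · subst hwr
        exact Or.inr h₃
      by_cases hws : w = s
      · exact Or.inr (Or.inl hws)
      have hel : lastIsElem w = true := by
        rcases hwrs with hwrs | hwrs
        · exact hP.lastIsElem_of_prefix hr hwrs (hP.ne_nil hw) hwr
        · exact hP.lastIsElem_of_prefix hs hwrs (hP.ne_nil hw) hws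
      rcases h₃ with rfl | h₃
      · rw [inter_eq_left List.prefix_rfl] at hrw
        rcases hwrs with h' | h' <;> exact absurd (h'.eq_of_length_le hrw.length_le) hwr
      · exact Or.inr (Or.inr (h₃.of_elem_of_inter_prefix hP hsat hr hs hel hrw))

end Soundness

/-! ### Completeness of the rules -/

section Completeness

variable {E A : Type}

/-- With respect to a set `X` of paths, `u` is doubled if some nonempty prefix of `u` is not in `X`. -/
def Doubled (X : Set (Path E A)) (u : Path E A) : Prop :=
  ∃ w, w ≠ [] ∧ w <+: u ∧ w ∉ X

theorem Doubled.mono {X : Set (Path E A)} {u w : Path E A} (h : Doubled X u) (hw : u <+: w) :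
    Doubled X w := by
  obtain ⟨v, h0, hv, hX⟩ := h
  exact ⟨v, h0, hv.trans hw, hX⟩

/-- The nodes of the two-copy tree: one node `(u, false)` for every path `u` of `P`, and a second
node `(u, true)` for the doubled paths. -/
abbrev TwoNode (P : List (Path E A)) (X : Set (Path E A)) : Type :=
  {y : Path E A × Bool // y.1 ∈ P ∧ (y.2 = true → Doubled X y.1)}

instance (P : List (Path E A)) (X : Set (Path E A)) : Finite (TwoNode P X) := by
  have h : ({u | u ∈ P} : Set (Path E A)).Finite := List.finite_toSet P
  exact ((h.prod (Set.finite_univ (α := Bool))).subset fun y hy => ⟨hy.1, trivial⟩).to_subtype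

/-- The edges of the two-copy tree: from `(u, c)` to `(w, b)` if `u` is the parent path of `w` and the
nodes are in the same copy or `u` is not doubled. -/
def TwoEdge {P : List (Path E A)} {X : Set (Path E A)} (x y : TwoNode P X) : Prop :=
  y.1.1.dropLast = x.1.1 ∧ (Doubled X x.1.1 → x.1.2 = y.1.2)

open Classical in
/-- The data of the two-copy tree. The strings of the two copies of an attribute or text node
differ if and only if its path is not in `X`. -/
@[reducible] noncomputable def twoData (rt : E) (P : List (Path E A)) (X : Set (Path E A))
    (root : TwoNode P X) : TreeData E A where
  V := TwoNode P X
  null := ∅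
  lab y := y.1.1.getLast?.getD (.inl rt)
  ele x := if lastIsElem x.1.1 = true then
      some ((Set.toFinite {y : TwoNode P X | TwoEdge x y ∧ lastIsAttr y.1.1 = false}).toFinset.toList)
    else none
  att x a := if h : ∃ y : TwoNode P X, TwoEdge x y ∧ y.1.1.getLast? = some (.inr (.inl a)) then
      some h.choose
    else none
  str y := if y.1.1 ∉ X ∧ y.1.2 = true then String.ofList [default] else String.ofList []
  root := root

variable {rt : E} {P : List (Path E A)} {X : Set (Path E A)} {root : TwoNode P X}

theorem IsPathSet.getLast?_eq_lab (hP : IsPathSet rt P) (y : TwoNode P X) :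
    y.1.1.getLast? = some ((twoData rt P X root).lab y) := by
  have h := hP.ne_nil y.2.1
  simp [List.getLast?_eq_getLast_of_ne_nil h]

theorem IsPathSet.isElem_lab (hP : IsPathSet rt P) (y : TwoNode P X) :
    isElem ((twoData rt P X root).lab y) = lastIsElem y.1.1 := by
  rw [lastIsElem, hP.getLast?_eq_lab (root := root) y]; rfl

theorem IsPathSet.isAttr_lab (hP : IsPathSet rt P) (y : TwoNode P X) :
    isAttr ((twoData rt P X root).lab y) = lastIsAttr y.1.1 := by
  rw [lastIsAttr, hP.getLast?_eq_lab (root := root) y]; rfl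

theorem IsPathSet.lastIsElem_of_twoEdge (hP : IsPathSet rt P) {x y : TwoNode P X}
    (h : TwoEdge x y) : lastIsElem x.1.1 = true := by
  rw [← h.1]
  exact hP.lastIsElem_dropLast y.2.1 (h.1 ▸ hP.ne_nil x.2.1)

theorem TwoEdge.append_lab (hP : IsPathSet rt P) {x y : TwoNode P X} (h : TwoEdge x y) :
    y.1.1 = x.1.1 ++ [(twoData rt P X root).lab y] := by
  have h1 := hP.getLast?_eq_lab (root := root) y
  obtain ⟨ys, hys⟩ := List.getLast?_eq_some_iff.1 h1
  have := h.1
  rw [hys, List.dropLast_concat] at this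
  rw [hys, this]

theorem TwoEdge.parent_unique {x x' y : TwoNode P X} (h : TwoEdge x y) (h' : TwoEdge x' y) :
    x = x' := by
  have h1 : x.1.1 = x'.1.1 := h.1.symm.trans h'.1
  refine Subtype.ext (Prod.ext h1 ?_)
  by_cases hd : Doubled X x.1.1
  · rw [h.2 hd, h'.2 (h1 ▸ hd)]
  · have e1 : x.1.2 = false := by
      by_contra hc
      exact hd (x.2.2 (by simpa using hc))
    have e2 : x'.1.2 = false := by
      by_contra hc
      exact hd (h1 ▸ x'.2.2 (by simpa using hc))
    rw [e1, e2]

/-- `X` contains, with an element path, its prefixes and attributes. -/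
def ElemClosed (P : List (Path E A)) (X : Set (Path E A)) : Prop :=
  ∀ w ∈ X, lastIsElem w = true → (∀ u ∈ P, u <+: w → u ∈ X) ∧
    ∀ u ∈ P, lastIsAttr u = true → u.dropLast = w → u ∈ X

theorem ElemClosed.not_doubled (hX : ElemClosed P X) (hP : IsPathSet rt P) {u : Path E A}
    (hu : u ∈ P) (hel : lastIsElem u = true) (h : u ∈ X) : ¬ Doubled X u := by
  rintro ⟨w, h0, hw, hwX⟩
  exact hwX ((hX u h hel).1 w (hP.prefixClosed u hu w h0 hw) hw)

/-- An attribute of a path that is not doubled is not doubled. -/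
theorem ElemClosed.doubled_dropLast (hX : ElemClosed P X) (hP : IsPathSet rt P) {u : Path E A}
    (hu : u ∈ P) (hat : lastIsAttr u = true) (h0 : u.dropLast ≠ []) (h : Doubled X u) :
    Doubled X u.dropLast := by
  by_contra hd
  obtain ⟨w, hw0, hw, hwX⟩ := h
  have hmem : u.dropLast ∈ P := hP.prefixClosed u hu _ h0 (List.dropLast_prefix u)
  have hdX : u.dropLast ∈ X := by
    by_contra hc
    exact hd ⟨_, h0, List.prefix_rfl, hc⟩
  by_cases hwu : w = u
  · subst hwu
    exact hwX ((hX _ hdX (hP.lastIsElem_dropLast hu h0)).2 w hu hat rfl)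
  · refine hd ⟨w, hw0, ?_, hwX⟩
    have : w.length < u.length := lt_of_le_of_ne hw.length_le fun h => hwu (hw.eq_of_length h)
    exact List.prefix_of_prefix_length_le hw (List.dropLast_prefix u)
      (by rw [List.length_dropLast]; omega)

theorem ElemClosed.attr_unique (hX : ElemClosed P X) (hP : IsPathSet rt P) {x y y' : TwoNode P X}
    (h : TwoEdge x y) (h' : TwoEdge x y') {a : A} (ha : y.1.1.getLast? = some (.inr (.inl a)))
    (ha' : y'.1.1.getLast? = some (.inr (.inl a))) : y = y' := by
  have e := h.append_lab (root := x) hP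
  have e' := h'.append_lab (root := x) hP
  have hy := hP.getLast?_eq_lab (root := x) y
  have hy' := hP.getLast?_eq_lab (root := x) y'
  rw [ha, Option.some.injEq] at hy
  rw [ha', Option.some.injEq] at hy'
  rw [← hy] at e
  rw [← hy'] at e'
  have h1 : y.1.1 = y'.1.1 := e.trans e'.symm
  refine Subtype.ext (Prod.ext h1 ?_)
  by_cases hd : Doubled X x.1.1
  · rw [← h.2 hd, ← h'.2 hd]
  · have hno : ¬ Doubled X y.1.1 := by
      intro hc
      have := hX.doubled_dropLast hP y.2.1 (by simp [lastIsAttr, ha, isAttr])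
        (by rw [h.1]; exact hP.ne_nil x.2.1) hc
      rw [h.1] at this
      exact hd this
    have e1 : y.1.2 = false := by
      by_contra hc
      exact hno (y.2.2 (by simpa using hc))
    have e2 : y'.1.2 = false := by
      by_contra hc
      exact hno (h1 ▸ y'.2.2 (by simpa using hc))
    rw [e1, e2]

theorem ElemClosed.isParent_iff (hX : ElemClosed P X) (hP : IsPathSet rt P) {x y : TwoNode P X} :
    (twoData rt P X root).IsParent x y ↔ TwoEdge x y := by
  constructor
  · rintro (⟨l, hl, hy⟩ | ⟨a, ha⟩)
    · simp only [twoData] at hl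
      split_ifs at hl
      obtain rfl := Option.some.inj hl
      simp only [Finset.mem_toList, Set.Finite.mem_toFinset, Set.mem_ofPred_eq] at hy
      exact hy.1
    · simp only [twoData] at ha
      split_ifs at ha with h
      obtain rfl := Option.some.inj ha
      exact h.choose_spec.1
  · intro h
    by_cases hat : lastIsAttr y.1.1 = true
    · right
      obtain ⟨a, ha⟩ : ∃ a, y.1.1.getLast? = some (.inr (.inl a)) := by
        have h1 := hP.getLast?_eq_lab (root := root) y
        have h2 := hP.isAttr_lab (root := root) y
        rw [hat] at h2
        rw [h1]
        revert h2
        rcases (twoData rt P X root).lab y with e | a | t <;> intro h2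
        · exact absurd h2 (by simp [isAttr])
        · exact ⟨a, rfl⟩
        · exact absurd h2 (by simp [isAttr])
      have hex : ∃ y : TwoNode P X, TwoEdge x y ∧ y.1.1.getLast? = some (.inr (.inl a)) :=
        ⟨y, h, ha⟩
      refine ⟨a, ?_⟩
      simp only [twoData]
      rw [dif_pos hex, hX.attr_unique hP hex.choose_spec.1 h hex.choose_spec.2 ha]
    · left
      refine ⟨_, if_pos (hP.lastIsElem_of_twoEdge h), ?_⟩
      simp only [Finset.mem_toList, Set.Finite.mem_toFinset, Set.mem_ofPred_eq]
      exact ⟨h, by simpa using hat⟩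

theorem exists_twoEdge (hP : IsPathSet rt P) (y : TwoNode P X) (hy : 1 < y.1.1.length) :
    ∃ x : TwoNode P X, TwoEdge x y := by
  have h0 : y.1.1.dropLast ≠ [] := by
    rw [← List.length_pos_iff, List.length_dropLast]; omega
  have hm := hP.prefixClosed _ y.2.1 _ h0 (List.dropLast_prefix _)
  by_cases hd : Doubled X y.1.1.dropLast
  · exact ⟨⟨(y.1.1.dropLast, y.1.2), hm, fun _ => hd⟩, rfl, fun _ => rfl⟩
  · exact ⟨⟨(y.1.1.dropLast, false), hm, by simp⟩, rfl, fun h => absurd h hd⟩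

theorem eq_root_of_length (hP : IsPathSet rt P) (hroot : rootPath A rt ∈ X)
    (hr : root.1 = (rootPath A rt, false)) {y : TwoNode P X} (hy : y.1.1.length ≤ 1) :
    y = root := by
  have h := hP.rootPath_prefix y.2.1
  have h1 : rootPath A rt = y.1.1 := h.eq_of_length_le hy
  have hd : ¬ Doubled X y.1.1 := by
    rintro ⟨w, hw0, hw, hwX⟩
    rw [← h1] at hw
    have hl := List.length_pos_iff.2 hw0
    rw [hw.eq_of_length_le hl] at hwX
    exact hwX hroot
  have h2 : y.1.2 = false := by
    by_contra hc
    exact hd (y.2.2 (by simpa using hc))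
  refine Subtype.ext ?_
  rw [hr, ← h2, h1]

/-- The two-copy tree of `X`. The paths all of whose prefixes are in `X` have one instance, the
other ones have two, which lie in two disjoint copies below their last common node. -/
@[reducible] noncomputable def twoTree (hP : IsPathSet rt P) (hX : ElemClosed P X) (hroot : rootPath A rt ∈ X)
    (root : TwoNode P X) (hr : root.1 = (rootPath A rt, false)) : ExtTree E A rt where
  toTreeData := twoData rt P X root
  finite := inferInstanceAs (Finite (TwoNode P X))
  lab_root := by
    show root.1.1.getLast?.getD (.inl rt) = _
    rw [hr]; rfl
  ele_lab v l h := by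
    rw [hP.isElem_lab (root := root) v]
    simp only [twoData] at h
    split_ifs at h with h'
    exact h'
  ele_child v l h w hw := by
    rw [hP.isAttr_lab (root := root) w]
    simp only [twoData] at h
    split_ifs at h with h'
    obtain rfl := Option.some.inj h
    simp only [Finset.mem_toList, Set.Finite.mem_toFinset, Set.mem_ofPred_eq] at hw
    exact hw.2
  ele_nodup v l h := by
    simp only [twoData] at h
    split_ifs at h with h'
    obtain rfl := Option.some.inj h
    exact Finset.nodup_toList _
  att_lab v a w h := by
    rw [hP.isElem_lab (root := root) v]
    simp only [twoData] at h
    split_ifs at h with h'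
    obtain rfl := Option.some.inj h
    refine ⟨hP.lastIsElem_of_twoEdge h'.choose_spec.1, ?_⟩
    have := hP.getLast?_eq_lab (root := root) h'.choose
    rw [h'.choose_spec.2, Option.some.injEq] at this
    exact this.symm
  root_top u h := by
    have h' := (hX.isParent_iff hP).1 h
    have := h'.1
    rw [show (twoData rt P X root).root = root from rfl, hr] at this
    exact hP.ne_nil (Subtype.prop u).1 this.symm
  parent_unique u u' v h h' :=
    ((hX.isParent_iff hP).1 h).parent_unique ((hX.isParent_iff hP).1 h')
  reachable v := by
    suffices H : ∀ n (y : TwoNode P X), y.1.1.length ≤ n + 1 →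
        Relation.ReflTransGen (twoData rt P X root).IsParent root y from H _ v (Nat.le_succ _)
    intro n
    induction n with
    | zero =>
      intro y hy
      rw [eq_root_of_length hP hroot hr hy]
    | succ n ih =>
      intro y hy
      by_cases h1 : y.1.1.length ≤ 1
      · rw [eq_root_of_length hP hroot hr h1]
      · obtain ⟨x, hx⟩ := exists_twoEdge hP y (by omega)
        refine (ih x ?_).tail ((hX.isParent_iff hP).2 hx)
        have := congrArg List.length hx.1
        rw [List.length_dropLast] at this
        omega

section TwoTree

variable {hP : IsPathSet rt P} {hX : ElemClosed P X} {hroot : rootPath A rt ∈ X}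
  {hr : root.1 = (rootPath A rt, false)}

/-- Along an instance of `u` in the two-copy tree, the nodes belong to the prefixes of `u`. -/
theorem twoTree_path_eq {u : Path E A} {vs : List (TwoNode P X)}
    (h : vs ∈ (twoTree hP hX hroot root hr).Paths u) :
    ∀ (i : ℕ) (hi : i < vs.length), vs[i].1.1 = u.take (i + 1) := by
  have h3 : vs.map (twoData rt P X root).lab = u := h.2.2
  have h1 : vs.head? = some root := h.1
  intro i
  induction i with
  | zero =>
    intro hi
    have h0 : vs[0] = root := by
      rw [List.head?_eq_getElem?, List.getElem?_eq_getElem hi] at h1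
      exact Option.some.inj h1
    rw [← h3, List.take_add_one, List.getElem?_map, List.getElem?_eq_getElem hi, h0]
    simp [hr, rootPath]
  | succ i ih =>
    intro hi
    have hp := (hX.isParent_iff hP).1 (List.isChain_iff_getElem.1 h.2.1 i hi)
    rw [hp.append_lab (root := root) hP, ih (by omega), List.take_add_one (i := i + 1)]
    congr 1
    rw [← h3, List.getElem?_map, List.getElem?_eq_getElem hi]
    rfl

/-- Along an instance in the two-copy tree, the copy does not change once the path is doubled. -/
theorem twoTree_copy_eq {u : Path E A} {vs : List (TwoNode P X)}
    (h : vs ∈ (twoTree hP hX hroot root hr).Paths u) {i : ℕ} (hi : i < vs.length)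
    (hd : Doubled X (u.take (i + 1))) :
    ∀ (j : ℕ) (hj : j < vs.length), i ≤ j → vs[j].1.2 = vs[i].1.2 := by
  intro j hj hij
  induction j, hij using Nat.le_induction with
  | base => rfl
  | succ j hij ih =>
    have hp := (hX.isParent_iff hP).1 (List.isChain_iff_getElem.1 h.2.1 j hj)
    rw [← ih (by omega)]
    refine (hp.2 ?_).symm
    rw [twoTree_path_eq h j (by omega)]
    refine hd.mono (List.take_prefix_take_left (by omega))

theorem exists_mem_twoTree_paths (y : TwoNode P X) :
    ∃ vs ∈ (twoTree hP hX hroot root hr).Paths y.1.1, vs.getLast? = some y := by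
  suffices H : ∀ n (y : TwoNode P X), y.1.1.length ≤ n + 1 →
      ∃ vs ∈ (twoTree hP hX hroot root hr).Paths y.1.1, vs.getLast? = some y from
    H _ y (Nat.le_succ _)
  intro n
  induction n with
  | zero =>
    intro y hy
    obtain rfl := eq_root_of_length hP hroot hr hy
    refine ⟨[y], ⟨rfl, List.isChain_singleton _, ?_⟩, rfl⟩
    simp [hr, rootPath]
  | succ n ih =>
    intro y hy
    by_cases h1 : y.1.1.length ≤ 1
    · exact ih y (by omega)
    · obtain ⟨x, hx⟩ := exists_twoEdge hP y (by omega)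
      have hlen := congrArg List.length hx.1
      rw [List.length_dropLast] at hlen
      obtain ⟨vs, hvs, hl⟩ := ih x (by omega)
      refine ⟨vs ++ [y], ⟨?_, ?_, ?_⟩, by simp⟩
      · rw [List.head?_append, hvs.1]; rfl
      · refine List.isChain_append.2 ⟨hvs.2.1, List.isChain_singleton _, ?_⟩
        intro a ha b hb
        rw [hl] at ha
        simp only [Option.mem_def, Option.some.injEq, List.head?_cons] at ha hb
        subst ha hb
        exact (hX.isParent_iff hP).2 hx
      · rw [List.map_append, hvs.2.2, hx.append_lab (root := root) hP]
        rfl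

theorem path_eq_of_getLast? {u : Path E A} {vs : List (TwoNode P X)}
    (h : vs ∈ (twoTree hP hX hroot root hr).Paths u) {y : TwoNode P X}
    (hy : vs.getLast? = some y) : y.1.1 = u := by
  have hl : vs.length = u.length := length_of_mem_paths h
  have h0 : vs ≠ [] := by rintro rfl; simp at hy
  have hpos := List.length_pos_iff.2 h0
  rw [List.getLast?_eq_getElem?] at hy
  obtain ⟨hi, rfl⟩ := List.getElem?_eq_some_iff.1 hy
  rw [twoTree_path_eq h, List.take_of_length_le (by omega)]

theorem copy_eq_false (y : TwoNode P X) (h : ¬ Doubled X y.1.1) : y.1.2 = false := by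
  by_contra hc
  exact h (y.2.2 (by simpa using hc))

theorem saturated_twoTree : Saturated P (twoTree hP hX hroot root hr) := by
  intro u hu (y : TwoNode P X) hy
  have hlast := hP.getLast?_eq_lab (root := root) y
  have hpre : y.1.1 <+: u := hP.prefix_of_getLast?_mem hu y.2.1 hlast hy
  obtain ⟨vs, hvs, hl⟩ := exists_mem_twoTree_paths (hP := hP) (hX := hX) (hroot := hroot)
    (hr := hr) ⟨(u, y.1.2), hu, fun h => (y.2.2 h).mono hpre⟩
  refine ⟨vs, hvs, ?_⟩
  have hlen : vs.length = u.length := length_of_mem_paths hvs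
  have hpos := hP.length_pos y.2.1
  have hle := hpre.length_le
  have hi : y.1.1.length - 1 < vs.length := by omega
  have hpath : vs[y.1.1.length - 1].1.1 = y.1.1 := by
    rw [twoTree_path_eq hvs, Nat.sub_add_cancel hpos, ← List.prefix_iff_eq_take.1 hpre]
  have hget : vs[y.1.1.length - 1] = y := by
    refine Subtype.ext (Prod.ext hpath ?_)
    by_cases hd : Doubled X y.1.1
    · have := twoTree_copy_eq hvs hi
        (by rwa [Nat.sub_add_cancel hpos, ← List.prefix_iff_eq_take.1 hpre])
        (vs.length - 1) (by omega) (by omega)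
      rw [← this]
      rw [List.getLast?_eq_getElem?, List.getElem?_eq_getElem (by omega)] at hl
      rw [Option.some.inj hl]
    · rw [copy_eq_false y hd, copy_eq_false _ (by rwa [hpath])]
  rw [← hget]
  exact List.getElem_mem hi

theorem isMinimalExtension_twoTree :
    IsMinimalExtension P (twoTree hP hX hroot root hr) (twoTree hP hX hroot root hr) := by
  refine ⟨id, Function.injective_id, ?_, rfl, fun _ => rfl, fun _ => rfl, fun _ _ => Iff.rfl,
    saturated_twoTree, ?_, ?_, ?_⟩
  · intro w
    exact iff_of_false (Set.notMem_empty w) (by simp)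
  all_goals exact fun w hw => absurd hw (Set.notMem_empty w)

theorem consistent_twoTree : Consistent (twoTree hP hX hroot root hr) P := by
  refine ⟨hP.consistent, ?_⟩
  intro (x : TwoNode P X) (y : TwoNode P X) h
  have h := (hX.isParent_iff hP).1 h
  have hx := hP.getLast?_eq_lab (root := root) x
  have hpos := hP.length_pos x.2.1
  have hap := h.append_lab (root := root) hP
  refine ⟨y.1.1, y.2.1, x.1.1.length - 1, x.1.1.length, by omega, ?_, ?_⟩
  · rw [hap, List.getElem?_append_left (by omega), ← List.getLast?_eq_getElem?, hx]
  · conv_lhs => rw [hap]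
    rw [List.getElem?_append_right le_rfl, Nat.sub_self]; rfl

theorem val_twoTree (y : TwoNode P X) (h : lastIsElem y.1.1 = false) :
    (twoTree hP hX hroot root hr).val y = .inr ((twoData rt P X root).str y) := by
  unfold TreeData.val
  refine if_neg ?_
  rintro (hc | hc)
  · have := hP.isElem_lab (root := root) y
    rw [h] at this
    exact Bool.false_ne_true (this.symm.trans hc)
  · exact hc

/-- The end nodes of any two instances of a path in `X` that does not end in an element label have
the same value. -/
theorem val_eq_of_mem {y y' : TwoNode P X} (h : y.1.1 = y'.1.1) (hel : lastIsElem y.1.1 = false)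
    (hmem : y.1.1 ∈ X) :
    (twoTree hP hX hroot root hr).val y = (twoTree hP hX hroot root hr).val y' := by
  rw [val_twoTree y hel, val_twoTree y' (h ▸ hel)]
  simp only [twoData]
  rw [if_neg (fun hc => hc.1 hmem), if_neg (fun hc => hc.1 (h ▸ hmem))]

theorem val_ne_of_not_mem {y y' : TwoNode P X} (h : y.1.1 = y'.1.1)
    (hmem : y.1.1 ∉ X) (hne : y ≠ y') :
    (twoTree hP hX hroot root hr).val y ≠ (twoTree hP hX hroot root hr).val y' := by
  by_cases hel : lastIsElem y.1.1 = true
  · have hlab : ∀ z : TwoNode P X, z.1.1 = y.1.1 →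
        (twoTree hP hX hroot root hr).val z = .inl z := fun z hz =>
      val_eq_inl (T := twoTree hP hX hroot root hr)
        ((hP.isElem_lab (root := root) z).trans (hz ▸ hel))
    rw [hlab y rfl, hlab y' h.symm]
    exact fun hc => hne (Sum.inl.inj hc)
  · have hel' : lastIsElem y.1.1 = false := by simpa using hel
    rw [val_twoTree y hel', val_twoTree y' (h ▸ hel')]
    have hcopy : y.1.2 ≠ y'.1.2 := fun hc => hne (Subtype.ext (Prod.ext h hc))
    have hstr : String.ofList [default] ≠ String.ofList [] := by simp
    simp only [twoData, ne_eq, Sum.inr.injEq]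
    cases hb : y.1.2 <;> cases hb' : y'.1.2
    · exact absurd (hb.trans hb'.symm) hcopy
    · rw [if_neg (by simp), if_pos ⟨h ▸ hmem, rfl⟩]
      exact hstr.symm
    · rw [if_pos ⟨hmem, rfl⟩, if_neg (by simp)]
      exact hstr
    · exact absurd (hb.trans hb'.symm) hcopy

/-- Instances that meet at a doubled path lie in the same copy. -/
theorem copy_eq_of_take_eq {u w : Path E A} {vs ws : List (TwoNode P X)}
    (h : vs ∈ (twoTree hP hX hroot root hr).Paths u)
    (h' : ws ∈ (twoTree hP hX hroot root hr).Paths w) {n : ℕ} (hn : 0 < n) (hnu : n ≤ u.length)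
    (hnw : n ≤ w.length) (ht : ws.take n = vs.take n) (hd : Doubled X (u.take n))
    (hd' : Doubled X (w.take n)) {y z : TwoNode P X} (hy : vs.getLast? = some y)
    (hz : ws.getLast? = some z) : z.1.2 = y.1.2 := by
  have hl : vs.length = u.length := length_of_mem_paths h
  have hl' : ws.length = w.length := length_of_mem_paths h'
  have e1 := twoTree_copy_eq h (i := n - 1) (by omega) (by rwa [Nat.sub_add_cancel hn])
    (vs.length - 1) (by omega) (by omega)
  have e2 := twoTree_copy_eq h' (i := n - 1) (by omega) (by rwa [Nat.sub_add_cancel hn])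
    (ws.length - 1) (by omega) (by omega)
  rw [List.getLast?_eq_getElem?, List.getElem?_eq_getElem (by omega), Option.some.injEq] at hy hz
  subst hy hz
  rw [e1, e2]
  have := getElem?_eq_of_take_eq hn ht
  rw [List.getElem?_eq_getElem (by omega), List.getElem?_eq_getElem (by omega),
    Option.some.injEq] at this
  rw [this]

theorem isXMLTree_twoTree : (twoTree hP hX hroot root hr).IsXMLTree := rfl

end TwoTree

variable [DecidableEq E] [DecidableEq A] {S : List (UnaryXFD E A)} {p : Path E A}

theorem RuleClosed.elemClosed (h : RuleClosed rt P S p X) : ElemClosed P X := fun w hw hel =>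
  ⟨fun u hu hpre => h.step w hw u hu (Or.inl ⟨hel, hpre⟩),
    fun u hu hat hdl => h.step w hw u hu (Or.inr (Or.inl ⟨hat, hdl⟩))⟩

/-- The two-copy tree of a closed set satisfies the XFDs: if `s ∈ X`, then no two instances of `s`
differ; otherwise `r ∩ s` is doubled, so that instances of `r` meeting different instances of `s`
are in different copies, and they have different values because `r ∉ X`. -/
theorem RuleClosed.satisfies_twoTree (h : RuleClosed rt P S p X) {hP : IsPathSet rt P}
    {hX : ElemClosed P X} {hroot : rootPath A rt ∈ X} {hr : root.1 = (rootPath A rt, false)}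
    {r s : Path E A} (hσ : (r, s) ∈ S) (hrP : r ∈ P) (hsP : s ∈ P) :
    Satisfies (twoTree hP hX hroot root hr) r s := by
  rintro (vs : List (TwoNode P X)) hvs (vs' : List (TwoNode P X)) hvs'
    ⟨hne, (y : TwoNode P X), (y' : TwoNode P X), hy, hy', hd⟩
    (zs : List (TwoNode P X)) hzs (zs' : List (TwoNode P X)) hzs' hm hm'
  have hpy := path_eq_of_getLast? hvs hy
  have hpy' := path_eq_of_getLast? hvs' hy'
  have hyne : y ≠ y' := by
    rintro rfl
    exact hne (eq_of_getLast?_eq hvs hvs' hy hy')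
  have hcopy : y.1.2 ≠ y'.1.2 := fun hc => hyne (Subtype.ext (Prod.ext (hpy.trans hpy'.symm) hc))
  by_cases hsX : s ∈ X
  · exfalso
    cases hel : lastIsElem s with
    | true =>
      have hnd := hX.not_doubled hP hsP hel hsX
      exact hcopy (by rw [copy_eq_false y (hpy ▸ hnd), copy_eq_false y' (hpy' ▸ hnd)])
    | false =>
      have hv := val_eq_of_mem (hP := hP) (hX := hX) (hroot := hroot) (hr := hr)
        (hpy.trans hpy'.symm) (by rw [hpy]; exact hel) (by rw [hpy]; exact hsX)
      rcases hd with hd | hd | hd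
      · exact Set.notMem_empty _ hd
      · exact Set.notMem_empty _ hd
      · exact hd hv
  · have happ : ∀ w ∈ X, inter r s <+: w → (w <+: r ∨ w <+: s) → False := fun w hw h1 h2 =>
      hsX (h.step w hw s hsP (Or.inr (Or.inr ⟨(r, s), hσ, rfl, h1, h2⟩)))
    have hrX : r ∉ X := fun hc => happ r hc (inter_prefix_left r s) (Or.inl List.prefix_rfl)
    have hiX : inter r s ∉ X := fun hc =>
      happ _ hc List.prefix_rfl (Or.inl (inter_prefix_left r s))
    have hi0 := hP.inter_ne_nil hrP hsP
    have hpos := List.length_pos_iff.2 hi0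
    have hid : Doubled X (inter r s) := ⟨_, hi0, List.prefix_rfl, hiX⟩
    obtain ⟨(z : TwoNode P X), hz⟩ := exists_getLast? hzs
    obtain ⟨(z' : TwoNode P X), hz'⟩ := exists_getLast? hzs'
    have hpz := path_eq_of_getLast? hzs hz
    have hpz' := path_eq_of_getLast? hzs' hz'
    have e := copy_eq_of_take_eq hvs hzs hpos (length_inter_le_right r s)
      (length_inter_le_left r s) hm (by rwa [take_length_inter_right])
      (by rwa [take_length_inter_left]) hy hz
    have e' := copy_eq_of_take_eq hvs' hzs' hpos (length_inter_le_right r s)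
      (length_inter_le_left r s) hm' (by rwa [take_length_inter_right])
      (by rwa [take_length_inter_left]) hy' hz'
    have hzne : z ≠ z' := by
      rintro rfl
      exact hcopy (e.symm.trans e')
    unfold Separated
    split_ifs
    · rintro rfl
      rw [hz] at hz'
      exact hzne (Option.some.inj hz')
    · intro x x' hx hx'
      rw [hz] at hx
      rw [hz'] at hx'
      obtain rfl := Option.some.inj hx
      obtain rfl := Option.some.inj hx'
      exact ⟨Set.notMem_empty _, Set.notMem_empty _,
        val_ne_of_not_mem (hpz.trans hpz'.symm) (by rw [hpz]; exact hrX) hzne⟩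

/-- A closed set contains all `q` with `p → q` implied: otherwise, its two-copy tree has two
instances of `q` that differ, but all instances of `p` have the same value. -/
theorem RuleClosed.mem_of_implies (h : RuleClosed rt P S p X) (hin : IsInput rt P S p)
    {q : Path E A} (hq : q ∈ P) (himp : Implies rt P S p q) : q ∈ X := by
  by_contra hqX
  have hP := hin.pathSet
  have hX := h.elemClosed
  let root : TwoNode P X := ⟨(rootPath A rt, false), hP.rootPath_mem hq, by simp⟩
  have hr : root.1 = (rootPath A rt, false) := rfl
  have hS : ∀ σ ∈ S, StronglySatisfies (twoTree hP hX h.root root hr) σ.1 σ.2 := by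
    rintro ⟨r, s⟩ hσ
    have hrs := hin.xfds _ hσ
    exact (stronglySatisfies_iff hP saturated_twoTree hrs.1 hrs.2).2
      (Or.inr (h.satisfies_twoTree hσ hrs.1 hrs.2))
  have hpq := (stronglySatisfies_iff hP saturated_twoTree hin.mem hq).1
    (himp _ _ isXMLTree_twoTree consistent_twoTree isMinimalExtension_twoTree hS)
  rcases hpq with rfl | hpq
  · exact hqX h.start
  have hd : Doubled X q := ⟨q, hP.ne_nil hq, List.prefix_rfl, hqX⟩
  let y : TwoNode P X := ⟨(q, true), hq, fun _ => hd⟩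
  let y' : TwoNode P X := ⟨(q, false), hq, fun _ => hd⟩
  have hyy : y ≠ y' := fun hc => by simpa [y, y'] using congrArg (fun z => z.1.2) hc
  obtain ⟨vs, hvs, hl⟩ := exists_mem_twoTree_paths (hP := hP) (hX := hX) (hroot := h.root)
    (hr := hr) y
  obtain ⟨vs', hvs', hl'⟩ := exists_mem_twoTree_paths (hP := hP) (hX := hX) (hroot := h.root)
    (hr := hr) y'
  have hD : Differ (twoTree hP hX h.root root hr) vs vs' := by
    refine ⟨?_, y, y', hl, hl', Or.inr (Or.inr (val_ne_of_not_mem rfl hqX hyy))⟩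
    rintro rfl
    rw [hl] at hl'
    exact hyy (Option.some.inj hl')
  have hpos := List.length_pos_iff.2 (hP.inter_ne_nil hin.mem hq)
  have hext : ∀ {ws}, ws ∈ (twoTree hP hX h.root root hr).Paths q →
      ∃ zs ∈ (twoTree hP hX h.root root hr).Paths p,
        zs.take (inter p q).length = ws.take (inter p q).length := fun hws =>
    saturated_twoTree.exists_extension hws hin.mem hpos (length_inter_le_right p q)
      (by rw [take_length_inter_right]; exact inter_prefix_left p q)
  obtain ⟨zs, hzs, hm⟩ := hext hvs
  obtain ⟨zs', hzs', hm'⟩ := hext hvs'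
  have hsep := hpq vs hvs vs' hvs' hD zs hzs zs' hzs' hm hm'
  rw [Separated, if_neg (by simp [hin.last])] at hsep
  obtain ⟨(z : TwoNode P X), hz⟩ := exists_getLast? hzs
  obtain ⟨(z' : TwoNode P X), hz'⟩ := exists_getLast? hzs'
  have hpz := path_eq_of_getLast? hzs hz
  have hpz' := path_eq_of_getLast? hzs' hz'
  exact (hsep z z' hz hz').2.2 (val_eq_of_mem (hpz.trans hpz'.symm)
    (by rw [hpz]; exact hin.last) (by rw [hpz]; exact h.start))

end Completeness

/-! ### Runs of the algorithm -/

section Runs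

variable {E A : Type} [DecidableEq E] [DecidableEq A] {rt : E} {P : List (Path E A)}
  {S : List (UnaryXFD E A)} {p : Path E A}

theorem mem_Anc {u w : Path E A} : u ∈ Anc w ↔ u <+: w ∧ u ≠ [] ∧ u ≠ w := by
  simp [Anc, List.mem_inits]

theorem mem_Att {u w : Path E A} : u ∈ Att P w ↔ u ∈ P ∧ u.dropLast = w ∧ lastIsAttr u = true := by
  simp [Att]

theorem mem_initClosure (hp : lastIsElem p = false) {q : Path E A} :
    q ∈ initClosure rt P p ↔ q = p ∨ q = rootPath A rt ∨ q ∈ Att P p ∨ q ∈ Att P (rootPath A rt) := by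
  simp [initClosure, hp]

theorem mem_extend {C : Finset (Path E A)} {s q : Path E A} :
    q ∈ extend P C s ↔ q ∈ C ∨ q = s ∨ lastIsElem s = true ∧
      (q ∈ Anc s ∨ ∃ w, (w = s ∨ w ∈ Anc s) ∧ q ∈ Att P w) := by
  unfold extend
  split_ifs with h
  · simp only [Finset.mem_union, Finset.mem_singleton, Finset.mem_biUnion, h, true_and, or_assoc]
  · simp [h, or_comm]

theorem Iteration.card_unused {c c' : State E A} (h : Iteration rt P c c') :
    c'.unused.card + 1 = c.unused.card := by
  obtain ⟨r, s, hσ, -, rfl⟩ := h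
  exact Finset.card_erase_add_one hσ

theorem Run.card_unused {n : ℕ} {c c' : State E A} (h : Run rt P n c c') :
    n + c'.unused.card = c.unused.card := by
  induction h with
  | refl => exact Nat.zero_add _
  | step _ hi ih =>
    have := hi.card_unused
    omega

/-- Every run can be continued until the loop stops. -/
theorem Run.exists_final {n : ℕ} {c c' : State E A} (h : Run rt P n c c') :
    ∃ m d, Run rt P m c d ∧ Final rt P d := by
  induction hk : c'.unused.card generalizing n c' with
  | zero =>
    refine ⟨n, c', h, ?_⟩
    rintro d ⟨r, s, hσ, -⟩
    rw [Finset.card_eq_zero.1 hk] at hσ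
    exact absurd hσ (Finset.notMem_empty _)
  | succ k ih =>
    by_cases hf : Final rt P c'
    · exact ⟨n, c', h, hf⟩
    · unfold Final at hf
      push Not at hf
      obtain ⟨d, hd, -⟩ := hf
      have := hd.card_unused
      exact ih (h.step hd) (by omega)

/-- All three forms of the test amount to the first one, with `r` or `root` in place of `p₁`. -/
theorem Applicable.exists_mem (hP : IsPathSet rt P) {C : Finset (Path E A)} {r s : Path E A}
    (hr : r ∈ P) (hroot : rootPath A rt ∈ C) (h : Applicable rt C r s) :
    ∃ w ∈ C, inter r s <+: w ∧ (w <+: r ∨ w <+: s) := by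
  rcases h with h | h | h
  · exact h
  · exact ⟨r, h, inter_prefix_left r s, Or.inl List.prefix_rfl⟩
  · exact ⟨_, hroot, h ▸ List.prefix_rfl, Or.inl (hP.rootPath_prefix hr)⟩

/-- What holds in every state that a run reaches: `P⁺` contains the initial paths and the right-hand
sides of the used XFDs, it is closed under the rules for element paths, and it is contained in every
closed set. -/
structure Reached (rt : E) (P : List (Path E A)) (S : List (UnaryXFD E A)) (p : Path E A)
    (c : State E A) : Prop where
  start : p ∈ c.closure
  root : rootPath A rt ∈ c.closure
  elem : ElemClosed P {u | u ∈ c.closure}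
  used : ∀ σ ∈ S, σ ∉ c.unused → σ.2 ∈ c.closure
  unused : ∀ σ ∈ c.unused, σ ∈ S
  least : ∀ X, RuleClosed rt P S p X → ∀ u ∈ c.closure, u ∈ X

theorem reached_initState (hin : IsInput rt P S p) : Reached rt P S p (initState rt P S p) := by
  have hP := hin.pathSet
  -- A path that does not end in an element label has no attributes.
  have hno : ∀ w, lastIsElem w = false → ∀ q, q ∈ Att P w → q = rootPath A rt := by
    intro w hw q hq
    obtain ⟨hqP, rfl, -⟩ := mem_Att.1 hq
    by_cases h0 : q.dropLast = []
    · have hlen := congrArg List.length h0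
      rw [List.length_dropLast, List.length_nil] at hlen
      exact ((hP.rootPath_prefix hqP).eq_of_length_le (by simp [rootPath]; omega)).symm
    · rw [hP.lastIsElem_dropLast hqP h0] at hw
      exact absurd hw.symm Bool.false_ne_true
  refine ⟨(mem_initClosure hin.last).2 (Or.inl rfl), (mem_initClosure hin.last).2 (Or.inr (Or.inl rfl)),
    ?_, ?_, fun σ hσ => List.mem_toFinset.1 hσ, ?_⟩
  · intro w hw hel
    have hw' : w = rootPath A rt := by
      rcases (mem_initClosure hin.last).1 hw with rfl | rfl | h | h
      · rw [hin.last] at hel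
        exact absurd hel Bool.false_ne_true
      · rfl
      · exact hno _ hin.last _ h
      · obtain ⟨-, -, hat⟩ := mem_Att.1 h
        exfalso
        unfold lastIsElem at hel
        unfold lastIsAttr at hat
        cases hl : w.getLast? with
        | none => simp [hl] at hel
        | some a => rcases a with e | a | t <;> simp [hl, isElem, isAttr] at hel hat
    subst hw'
    refine ⟨fun u hu hpre => ?_, fun u hu hat hdl => ?_⟩
    · rw [(hP.rootPath_prefix hu).eq_of_length_le hpre.length_le] at hw
      exact hw
    · exact (mem_initClosure hin.last).2 (Or.inr (Or.inr (Or.inr (mem_Att.2 ⟨hu, hdl, hat⟩))))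
  · intro σ hσ hn
    exact absurd (List.mem_toFinset.2 hσ) hn
  · intro X hX u hu
    rcases (mem_initClosure hin.last).1 hu with rfl | rfl | h | h
    · exact hX.start
    · exact hX.root
    · obtain ⟨hu, hdl, hat⟩ := mem_Att.1 h
      exact hX.step _ hX.start u hu (Or.inr (Or.inl ⟨hat, hdl⟩))
    · obtain ⟨hu, hdl, hat⟩ := mem_Att.1 h
      exact hX.step _ hX.root u hu (Or.inr (Or.inl ⟨hat, hdl⟩))

theorem Reached.iteration (hin : IsInput rt P S p) {c c' : State E A} (h : Reached rt P S p c)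
    (hi : Iteration rt P c c') : Reached rt P S p c' := by
  have hP := hin.pathSet
  obtain ⟨r, s, hσ, happ, rfl⟩ := hi
  have hrs := hin.xfds _ (h.unused _ hσ)
  refine ⟨mem_extend.2 (Or.inl h.start), mem_extend.2 (Or.inl h.root), ?_, ?_,
    fun σ hσ' => h.unused _ (Finset.mem_of_mem_erase hσ'), ?_⟩
  · intro w hw hel
    rcases mem_extend.1 hw with hw | hw
    · exact ⟨fun u hu hpre => mem_extend.2 (Or.inl ((h.elem w hw hel).1 u hu hpre)),
        fun u hu hat hdl => mem_extend.2 (Or.inl ((h.elem w hw hel).2 u hu hat hdl))⟩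
    · have hw' : lastIsElem s = true ∧ w <+: s := by
        rcases hw with rfl | ⟨hs, hw | ⟨v, -, hw⟩⟩
        · exact ⟨hel, List.prefix_rfl⟩
        · exact ⟨hs, (mem_Anc.1 hw).1⟩
        · rw [not_lastIsElem_of_lastIsAttr (mem_Att.1 hw).2.2] at hel
          exact absurd hel Bool.false_ne_true
      have hanc : ∀ u : Path E A, u ≠ [] → u <+: s → u = s ∨ u ∈ Anc s := by
        intro u hu hpre
        by_cases he : u = s
        · exact Or.inl he
        · exact Or.inr (mem_Anc.2 ⟨hpre, hu, he⟩)
      refine ⟨fun u hu hpre => mem_extend.2 (Or.inr ?_),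
        fun u hu hat hdl => mem_extend.2 (Or.inr (Or.inr ⟨hw'.1, Or.inr ⟨w, ?_, ?_⟩⟩))⟩
      · exact (hanc u (hP.ne_nil hu) (hpre.trans hw'.2)).imp_right fun h => ⟨hw'.1, Or.inl h⟩
      · refine hanc w ?_ hw'.2
        rintro rfl
        simp [lastIsElem] at hel
      · exact mem_Att.2 ⟨hu, hdl, hat⟩
  · intro σ hS hn
    by_cases he : σ = (r, s)
    · subst he
      exact mem_extend.2 (Or.inr (Or.inl rfl))
    · exact mem_extend.2 (Or.inl (h.used σ hS fun hc => hn (Finset.mem_erase.2 ⟨he, hc⟩)))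
  · intro X hX u hu
    obtain ⟨w, hw, h1, h2⟩ := happ.exists_mem hP hrs.1 h.root
    have hsX : s ∈ X := hX.step w (h.least X hX w hw) s hrs.2
      (Or.inr (Or.inr ⟨(r, s), h.unused _ hσ, rfl, h1, h2⟩))
    have hanc : ∀ v, lastIsElem s = true → v ∈ Anc s → v ∈ X := fun v hs hv =>
      hX.step s hsX v (hP.prefixClosed s hrs.2 v (mem_Anc.1 hv).2.1 (mem_Anc.1 hv).1)
        (Or.inl ⟨hs, (mem_Anc.1 hv).1⟩)
    rcases mem_extend.1 hu with hu | rfl | ⟨hs, hu | ⟨v, hv, hu⟩⟩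
    · exact h.least X hX u hu
    · exact hsX
    · exact hanc u hs hu
    · have hvX : v ∈ X := by
        rcases hv with rfl | hv
        · exact hsX
        · exact hanc v hs hv
      obtain ⟨hu, hdl, hat⟩ := mem_Att.1 hu
      exact hX.step v hvX u hu (Or.inr (Or.inl ⟨hat, hdl⟩))

theorem Run.reached (hin : IsInput rt P S p) {n : ℕ} {c : State E A}
    (h : Run rt P n (initState rt P S p) c) : Reached rt P S p c := by
  generalize hd : initState rt P S p = d at h
  induction h with
  | refl => exact hd ▸ reached_initState hin
  | step _ hi ih => exact (ih hd).iteration hin hi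

theorem Reached.ruleClosed (hin : IsInput rt P S p) {c : State E A} (h : Reached rt P S p c) (hf : Final rt P c) :
    RuleClosed rt P S p {u | u ∈ c.closure} := by
  refine ⟨h.start, h.root, ?_⟩
  rintro w hw u hu (⟨hel, hpre⟩ | ⟨hat, hdl⟩ | ⟨⟨r, s⟩, hσ, rfl, h1, h2⟩)
  · exact (h.elem w hw hel).1 u hu hpre
  · refine (h.elem w hw ?_).2 u hu hat hdl
    subst hdl
    exact hin.pathSet.lastIsElem_dropLast hu
      (hin.pathSet.ne_nil (h.least _ (ruleClosed_implies hin) _ hw).1)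
  · by_cases hun : (r, s) ∈ c.unused
    · have := hf _ ⟨r, s, hun, Or.inl ⟨w, hw, h1, h2⟩, rfl⟩
      exact this ▸ mem_extend.2 (Or.inr (Or.inl rfl))
    · exact h.used _ hσ hun

/-- A closed set that is contained in every closed set consists of the implied paths. -/
theorem RuleClosed.mem_iff_of_least (hin : IsInput rt P S p) {X : Set (Path E A)}
    (h : RuleClosed rt P S p X) (hl : ∀ Y, RuleClosed rt P S p Y → ∀ u ∈ X, u ∈ Y) (q : Path E A) :
    q ∈ X ↔ q ∈ P ∧ Implies rt P S p q :=
  ⟨fun hq => hl _ (ruleClosed_implies hin) q hq, fun hq => h.mem_of_implies hin hq.1 hq.2⟩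

end Runs

/-! ### Values and costs of timed computations -/

section Timed

variable {α β : Type}

@[simp] theorem Timed.val_pure (a : α) : (pure a : Timed α).val = a := rfl
@[simp] theorem Timed.time_pure (a : α) : (pure a : Timed α).time = 0 := rfl
@[simp] theorem Timed.val_bind (x : Timed α) (f : α → Timed β) :
    (x >>= f).val = (f x.val).val := rfl
@[simp] theorem Timed.time_bind (x : Timed α) (f : α → Timed β) :
    (x >>= f).time = x.time + (f x.val).time := rfl
@[simp] theorem time_spend (n : ℕ) : (spend n).time = n := rfl

variable {body : α → β → Timed β}

theorem forEach_nil_val (b : β) : (forEach body [] b).val = b := rfl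

theorem forEach_cons_val (a : α) (l : List α) (b : β) :
    (forEach body (a :: l) b).val = (forEach body l (body a b).val).val := rfl

theorem forEach_time_le {K : ℕ} {l : List α} (h : ∀ a ∈ l, ∀ b, (body a b).time ≤ K) (b : β) :
    (forEach body l b).time ≤ l.length * (K + 1) + 1 := by
  induction l generalizing b with
  | nil => simp [forEach]
  | cons a l ih =>
    have h1 := h a (by simp) b
    have h2 := ih (fun x hx => h x (by simp [hx])) (body a b).val
    simp only [forEach, Timed.time_bind, time_spend, List.length_cons]
    rw [Nat.succ_mul]
    omega

/-- If every execution of the loop body increases a measure by at most `K`, then a loop over `l`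
increases it by at most `|l| * K`. -/
theorem forEach_measure_le {K : ℕ} (μ : β → ℕ) {l : List α}
    (h : ∀ a ∈ l, ∀ b, μ (body a b).val ≤ μ b + K) (b : β) :
    μ (forEach body l b).val ≤ μ b + l.length * K := by
  induction l generalizing b with
  | nil => simp [forEach_nil_val]
  | cons a l ih =>
    have h1 := h a (by simp) b
    have h2 := ih (fun x hx => h x (by simp [hx])) (body a b).val
    rw [forEach_cons_val, List.length_cons, Nat.succ_mul]
    omega

end Timed

/-! ### The index -/

section Index

variable {E A : Type}

/-- If the loop body for `a` adds exactly the links `L a`, then the loop over `l` adds the links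
`L a` for all members `a` of `l`. -/
theorem mem_forEach_iff {α : Type} {body : α → Next E A → Timed (Next E A)}
    {L : α → Path E A → Path E A → Prop} {l : List α}
    (h : ∀ a ∈ l, ∀ t v x, x ∈ (body a t).val v ↔ x ∈ t v ∨ L a v x) (t : Next E A)
    (v x : Path E A) : x ∈ (forEach body l t).val v ↔ x ∈ t v ∨ ∃ a ∈ l, L a v x := by
  induction l generalizing t with
  | nil => simp [forEach_nil_val]
  | cons a l ih =>
    rw [forEach_cons_val, ih (fun y hy => h y (by simp [hy])), h a (by simp)]
    simp [or_assoc]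

/-- The number of links that leave the paths of `D`. -/
def linkCount (D : Finset (Path E A)) (t : Next E A) : ℕ := ∑ u ∈ D, (t u).length

variable [DecidableEq E] [DecidableEq A]

theorem mem_addLink_iff {u w : Path E A} {t : Next E A} {v x : Path E A} :
    x ∈ (addLink u w t).val v ↔ x ∈ t v ∨ (v = u ∧ x = w) := by
  show x ∈ Function.update t u (w :: t u) v ↔ _
  by_cases h : v = u
  · subst h
    simp [or_comm]
  · simp [h]

theorem time_addLink (u w : Path E A) (t : Next E A) :
    (addLink u w t).time = 2 * (u.length + 1) := by
  show (u.length + 1) + (u.length + 1) = _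
  ring

theorem linkCount_addLink_le (D : Finset (Path E A)) (u w : Path E A) (t : Next E A) :
    linkCount D (addLink u w t).val ≤ linkCount D t + 1 := by
  show ∑ v ∈ D, (Function.update t u (w :: t u) v).length ≤ ∑ v ∈ D, (t v).length + 1
  calc ∑ v ∈ D, (Function.update t u (w :: t u) v).length
      ≤ ∑ v ∈ D, ((t v).length + if v = u then 1 else 0) := by
        refine Finset.sum_le_sum fun v _ => ?_
        by_cases h : v = u
        · subst h
          simp
        · simp [h]
    _ ≤ ∑ v ∈ D, (t v).length + 1 := by
        rw [Finset.sum_add_distrib, Finset.sum_ite_eq']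
        split_ifs <;> omega

theorem mem_indexPath_iff {u : Path E A} {t : Next E A} {v x : Path E A} :
    x ∈ (indexPath u t).val v ↔ x ∈ t v ∨
      ((lastIsElem u = true ∧ v = u ∧ x <+: u ∧ x ≠ [] ∧ x ≠ u) ∨
        (lastIsElem u = false ∧ lastIsAttr u = true ∧ v = u.dropLast ∧ x = u)) := by
  unfold indexPath
  simp only [Timed.val_bind]
  split_ifs with h1 h2
  · rw [mem_forEach_iff (L := fun w v x => (w ≠ [] ∧ w ≠ u) ∧ v = u ∧ x = w)]
    · simp only [List.mem_inits, h1]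
      refine or_congr_right ⟨?_, ?_⟩
      · rintro ⟨w, hw, ⟨h3, h4⟩, rfl, rfl⟩
        exact Or.inl ⟨trivial, rfl, hw, h3, h4⟩
      · rintro (⟨-, rfl, hx, h3, h4⟩ | ⟨h, -⟩)
        · exact ⟨x, hx, ⟨h3, h4⟩, rfl, rfl⟩
        · exact absurd h (by simp)
    · intro w _ t v x
      simp only [Timed.val_bind]
      split_ifs with h
      · rw [mem_addLink_iff]
        simp [h]
      · simp [h]
  · rw [mem_addLink_iff]
    simp [h1, h2]
  · simp [h1, h2]

theorem time_indexPath_le {M : ℕ} {u : Path E A} (hu : u.length + 1 ≤ M) (t : Next E A) :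
    (indexPath u t).time ≤ 3 * M * M + 2 * M + 1 := by
  unfold indexPath
  simp only [Timed.time_bind, time_spend]
  split_ifs with h1 h2
  · refine le_trans (Nat.add_le_add_left (forEach_time_le (K := 3 * M) ?_ t) _) ?_
    · intro w hw t
      have hw := ((List.mem_inits _ _).1 hw).length_le
      simp only [Timed.time_bind, time_spend]
      split_ifs
      · rw [time_addLink]
        omega
      · simp only [Timed.time_pure]
        omega
    · rw [List.length_inits]
      have := Nat.mul_le_mul_right (3 * M + 1) hu
      nlinarith
  · rw [time_addLink, List.length_dropLast]
    nlinarith [Nat.zero_le (M * M), show u.length - 1 + 1 ≤ M by omega]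
  · simp only [Timed.time_pure]
    nlinarith [Nat.zero_le (M * M)]

theorem linkCount_indexPath_le (D : Finset (Path E A)) {M : ℕ} {u : Path E A}
    (hu : u.length + 1 ≤ M) (t : Next E A) :
    linkCount D (indexPath u t).val ≤ linkCount D t + M := by
  unfold indexPath
  simp only [Timed.val_bind]
  split_ifs with h1 h2
  · refine le_trans (forEach_measure_le (K := 1) (linkCount D) ?_ t) ?_
    · intro w _ t
      simp only [Timed.val_bind]
      split_ifs
      · exact linkCount_addLink_le D u w t
      · exact Nat.le_succ _
    · rw [List.length_inits]
      omega
  · have := linkCount_addLink_le D u.dropLast u t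
    omega
  · exact Nat.le_add_right _ _

theorem mem_indexXFD_iff {σ : UnaryXFD E A} {t : Next E A} {v x : Path E A} :
    x ∈ (indexXFD σ t).val v ↔ x ∈ t v ∨
      (x = σ.2 ∧ (inter σ.1 σ.2).length ≤ v.length ∧ (v <+: σ.1 ∨ v <+: σ.2)) := by
  unfold indexXFD
  simp only [Timed.val_bind]
  have hbody : ∀ (l : List (Path E A)), ∀ w ∈ l, ∀ (t : Next E A) (v x : Path E A),
      x ∈ ((fun (w : Path E A) (t : Next E A) => (do
        spend (w.length + 1)
        if (inter σ.1 σ.2).length ≤ w.length then addLink w σ.2 t else pure t)) w t).val v ↔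
      x ∈ t v ∨ (fun (w v x : Path E A) =>
        (inter σ.1 σ.2).length ≤ w.length ∧ v = w ∧ x = σ.2) w v x := by
    intro l w _ t v x
    simp only [Timed.val_bind]
    split_ifs with h
    · rw [mem_addLink_iff]
      simp [h]
    · simp [h]
  rw [mem_forEach_iff (hbody _), mem_forEach_iff (hbody _), or_assoc]
  simp only [List.mem_inits]
  refine or_congr_right ⟨?_, ?_⟩
  · rintro (⟨w, hw, hk, rfl, rfl⟩ | ⟨w, hw, hk, rfl, rfl⟩)
    · exact ⟨rfl, hk, Or.inl hw⟩
    · exact ⟨rfl, hk, Or.inr hw⟩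
  · rintro ⟨rfl, hk, hv | hv⟩
    · exact Or.inl ⟨v, hv, hk, rfl, rfl⟩
    · exact Or.inr ⟨v, hv, hk, rfl, rfl⟩

theorem time_indexXFD_le {M : ℕ} {σ : UnaryXFD E A} (h1 : σ.1.length + 1 ≤ M)
    (h2 : σ.2.length + 1 ≤ M) (t : Next E A) :
    (indexXFD σ t).time ≤ 6 * M * M + 4 * M + 2 := by
  unfold indexXFD
  simp only [Timed.time_bind, time_spend]
  have hloop : ∀ (u : Path E A), u.length + 1 ≤ M → ∀ t : Next E A,
      (forEach (fun (w : Path E A) (t : Next E A) => (do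
        spend (w.length + 1)
        if (inter σ.1 σ.2).length ≤ w.length then addLink w σ.2 t else pure t)) u.inits t).time ≤
      M * (3 * M + 1) + 1 := by
    intro u hu t
    refine le_trans (forEach_time_le (K := 3 * M) ?_ t) ?_
    · intro w hw t
      have hw := ((List.mem_inits _ _).1 hw).length_le
      simp only [Timed.time_bind, time_spend]
      split_ifs
      · rw [time_addLink]
        omega
      · simp only [Timed.time_pure]
        omega
    · rw [List.length_inits]
      have := Nat.mul_le_mul_right (3 * M + 1) hu
      omega
  have e1 := hloop _ h1 t
  refine le_trans (Nat.add_le_add_left (Nat.add_le_add e1 (hloop _ h2 _)) _) ?_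
  nlinarith

theorem linkCount_indexXFD_le (D : Finset (Path E A)) {M : ℕ} {σ : UnaryXFD E A}
    (h1 : σ.1.length + 1 ≤ M) (h2 : σ.2.length + 1 ≤ M) (t : Next E A) :
    linkCount D (indexXFD σ t).val ≤ linkCount D t + 2 * M := by
  unfold indexXFD
  simp only [Timed.val_bind]
  have hbody : ∀ (l : List (Path E A)), ∀ w ∈ l, ∀ t : Next E A,
      linkCount D ((fun (w : Path E A) (t : Next E A) => (do
        spend (w.length + 1)
        if (inter σ.1 σ.2).length ≤ w.length then addLink w σ.2 t else pure t)) w t).val ≤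
      linkCount D t + 1 := by
    intro l w _ t
    simp only [Timed.val_bind]
    split_ifs
    · exact linkCount_addLink_le D w σ.2 t
    · exact Nat.le_succ _
  refine le_trans (forEach_measure_le (linkCount D) (hbody _) _) ?_
  refine le_trans (Nat.add_le_add_right (forEach_measure_le (linkCount D) (hbody _) _) _) ?_
  rw [List.length_inits, List.length_inits]
  omega

/-- The index that the implementation builds. -/
def linkTable (P : List (Path E A)) (S : List (UnaryXFD E A)) : Next E A :=
  (forEach indexXFD S (forEach indexPath P (fun _ => [])).val).val

variable {rt : E} {P : List (Path E A)} {S : List (UnaryXFD E A)} {p : Path E A}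

theorem mem_linkTable_iff {v x : Path E A} : x ∈ linkTable P S v ↔
    (∃ u ∈ P, (lastIsElem u = true ∧ v = u ∧ x <+: u ∧ x ≠ [] ∧ x ≠ u) ∨
      (lastIsElem u = false ∧ lastIsAttr u = true ∧ v = u.dropLast ∧ x = u)) ∨
    ∃ σ ∈ S, x = σ.2 ∧ (inter σ.1 σ.2).length ≤ v.length ∧ (v <+: σ.1 ∨ v <+: σ.2) := by
  unfold linkTable
  rw [mem_forEach_iff fun σ _ t v x => mem_indexXFD_iff,
    mem_forEach_iff fun u _ t v x => mem_indexPath_iff]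
  simp

theorem derives_of_mem_linkTable (hin : IsInput rt P S p) {v x : Path E A}
    (h : x ∈ linkTable P S v) : x ∈ P ∧ Derives S v x := by
  have hP := hin.pathSet
  rcases mem_linkTable_iff.1 h with ⟨u, hu, ⟨hel, rfl, hx, h0, -⟩ | ⟨-, hat, rfl, rfl⟩⟩ |
      ⟨σ, hσ, rfl, hk, hv⟩
  · exact ⟨hP.prefixClosed _ hu x h0 hx, Or.inl ⟨hel, hx⟩⟩
  · exact ⟨hu, Or.inr (Or.inl ⟨hat, rfl⟩)⟩
  · refine ⟨(hin.xfds σ hσ).2, Or.inr (Or.inr ⟨σ, hσ, rfl, ?_, hv⟩)⟩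
    rcases hv with hv | hv
    · exact List.prefix_of_prefix_length_le (inter_prefix_left _ _) hv hk
    · exact List.prefix_of_prefix_length_le (inter_prefix_right _ _) hv hk

/-- The index realizes all rules, except that no path is linked to itself as a prefix. -/
theorem mem_linkTable_of_derives (hin : IsInput rt P S p) {v x : Path E A} (hv : v ∈ P)
    (hx : x ∈ P) (h : Derives S v x) : x = v ∨ x ∈ linkTable P S v := by
  have hP := hin.pathSet
  by_cases he : x = v
  · exact Or.inl he
  refine Or.inr (mem_linkTable_iff.2 ?_)
  rcases h with ⟨hel, hpre⟩ | ⟨hat, rfl⟩ | ⟨σ, hσ, rfl, hk, hv⟩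
  · exact Or.inl ⟨v, hv, Or.inl ⟨hel, rfl, hpre, hP.ne_nil hx, he⟩⟩
  · exact Or.inl ⟨x, hx, Or.inr ⟨not_lastIsElem_of_lastIsAttr hat, hat, rfl, rfl⟩⟩
  · exact Or.inr ⟨σ, hσ, rfl, hk.length_le, hv⟩

theorem linkCount_linkTable_le {M : ℕ} (hM : ∀ u ∈ P, u.length + 1 ≤ M)
    (hS : ∀ σ ∈ S, σ.1 ∈ P ∧ σ.2 ∈ P) (D : Finset (Path E A)) :
    linkCount D (linkTable P S) ≤ P.length * M + S.length * (2 * M) := by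
  refine le_trans (forEach_measure_le (linkCount D) (fun σ hσ t => linkCount_indexXFD_le D
    (hM _ (hS σ hσ).1) (hM _ (hS σ hσ).2) t) _) (Nat.add_le_add_right ?_ _)
  refine le_trans (forEach_measure_le (linkCount D) (fun u hu t => linkCount_indexPath_le D
    (hM u hu) t) _) ?_
  simp [linkCount]

end Index

/-! ### The worklist search -/

section Search

variable {E A : Type}

/-- The state of the search relative to the set `D` of the paths processed so far: the paths found,
all of them in `Q`, are those in `D` and, without repetition, those on the agenda. -/
structure StoreInv (Q D : Finset (Path E A)) (c : Store E A) : Prop where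
  known : ∀ u, c.known u = true ↔ u ∈ c.found
  split : ∀ u, u ∈ c.found ↔ u ∈ D ∨ u ∈ c.agenda
  nodup : c.agenda.Nodup
  fresh : ∀ u ∈ c.agenda, u ∉ D
  bound : ∀ u ∈ c.found, u ∈ Q

variable [DecidableEq E] [DecidableEq A] {Q D : Finset (Path E A)} {c : Store E A}

theorem time_insertPath_le (u : Path E A) (c : Store E A) :
    (insertPath u c).time ≤ 2 * (u.length + 1) + 2 := by
  unfold insertPath
  simp only [Timed.time_bind, readTable]
  split_ifs
  · simp only [Timed.time_pure]
    omega
  · simp only [Timed.time_bind, writeTable, time_spend, Timed.time_pure]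
    omega

theorem StoreInv.insertPath {u : Path E A} (h : StoreInv Q D c) (hu : u ∈ Q) :
    StoreInv Q D (insertPath u c).val ∧ ∀ x, x ∈ (insertPath u c).val.found ↔ x = u ∨ x ∈ c.found := by
  unfold XML.insertPath
  simp only [Timed.val_bind, readTable]
  split_ifs with hk
  · have hm := (h.known u).1 hk
    refine ⟨h, fun x => ⟨Or.inr, ?_⟩⟩
    rintro (rfl | hx)
    · exact hm
    · exact hx
  · have hm : u ∉ c.found := fun hc => hk ((h.known u).2 hc)
    refine ⟨⟨?_, ?_, ?_, ?_, ?_⟩, fun x => List.mem_cons⟩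
    · intro x
      show Function.update c.known u true x = true ↔ x ∈ u :: c.found
      by_cases hx : x = u
      · subst hx
        simp
      · simp [hx, h.known]
    · intro x
      show x ∈ u :: c.found ↔ x ∈ D ∨ x ∈ u :: c.agenda
      rw [List.mem_cons, List.mem_cons, h.split]
      tauto
    · exact List.nodup_cons.2 ⟨fun hc => hm ((h.split u).2 (Or.inr hc)), h.nodup⟩
    · intro x hx
      rcases List.mem_cons.1 hx with rfl | hx
      · exact fun hc => hm ((h.split x).2 (Or.inl hc))
      · exact h.fresh x hx
    · intro x hx
      rcases List.mem_cons.1 hx with rfl | hx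
      · exact hu
      · exact h.bound x hx

theorem StoreInv.forEach_insertPath {l : List (Path E A)} (h : StoreInv Q D c)
    (hl : ∀ u ∈ l, u ∈ Q) : StoreInv Q D (forEach XML.insertPath l c).val ∧
      ∀ x, x ∈ (forEach XML.insertPath l c).val.found ↔ x ∈ l ∨ x ∈ c.found := by
  induction l generalizing c with
  | nil => exact ⟨h, fun x => by simp [forEach_nil_val]⟩
  | cons u l ih =>
    obtain ⟨h1, h2⟩ := h.insertPath (hl u (by simp))
    obtain ⟨h3, h4⟩ := ih h1 fun x hx => hl x (by simp [hx])
    refine ⟨h3, fun x => ?_⟩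
    rw [forEach_cons_val, h4, h2, List.mem_cons]
    tauto

theorem StoreInv.pop {u : Path E A} {rest : List (Path E A)} (h : StoreInv Q D c)
    (hc : c.agenda = u :: rest) : StoreInv Q (insert u D) { c with agenda := rest } := by
  have hn := h.nodup
  rw [hc, List.nodup_cons] at hn
  refine ⟨h.known, ?_, hn.2, ?_, h.bound⟩
  · intro x
    show x ∈ c.found ↔ x ∈ insert u D ∨ x ∈ rest
    rw [h.split, hc, List.mem_cons, Finset.mem_insert]
    tauto
  · intro x hx hm
    rcases Finset.mem_insert.1 hm with rfl | hm
    · exact hn.1 hx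
    · exact h.fresh x (by rw [hc]; exact List.mem_cons_of_mem _ hx) hm

theorem mainLoop_succ_nil {t : Next E A} {n : ℕ} (hc : c.agenda = []) :
    mainLoop t (n + 1) c = ⟨c, 1⟩ := by
  simp only [mainLoop, hc]
  rfl

theorem mainLoop_succ_cons {t : Next E A} {n : ℕ} {u : Path E A} {rest : List (Path E A)}
    (hc : c.agenda = u :: rest) :
    mainLoop t (n + 1) c =
      ⟨(mainLoop t n (forEach insertPath (t u) { c with agenda := rest }).val).val,
        1 + (u.length + 1 + ((forEach insertPath (t u) { c with agenda := rest }).time +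
          (mainLoop t n (forEach insertPath (t u) { c with agenda := rest }).val).time))⟩ := by
  simp only [mainLoop, hc]
  rfl

variable {t : Next E A}

/-- Each round processes a new path of `Q`, so that `|Q|` rounds suffice to empty the agenda. -/
theorem StoreInv.mainLoop (hQ : ∀ u ∈ Q, ∀ w ∈ t u, w ∈ Q) {n : ℕ} (h : StoreInv Q D c)
    (hD : ∀ u ∈ D, ∀ w ∈ t u, w ∈ c.found) (hn : Q.card ≤ n + D.card) :
    (∀ u ∈ c.found, u ∈ (mainLoop t n c).val.found) ∧
    (∀ u ∈ (mainLoop t n c).val.found, u ∈ Q) ∧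
    ∀ u ∈ (mainLoop t n c).val.found, ∀ w ∈ t u, w ∈ (mainLoop t n c).val.found := by
  induction n generalizing c D with
  | zero =>
    show (∀ u ∈ c.found, u ∈ c.found) ∧ (∀ u ∈ c.found, u ∈ Q) ∧
      ∀ u ∈ c.found, ∀ w ∈ t u, w ∈ c.found
    have hDQ : D ⊆ Q := fun u hu => h.bound u ((h.split u).2 (Or.inl hu))
    have heq : D = Q := Finset.eq_of_subset_of_card_le hDQ (by omega)
    exact ⟨fun u hu => hu, h.bound, fun u hu => hD u (heq ▸ h.bound u hu)⟩
  | succ n ih =>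
    cases hc : c.agenda with
    | nil =>
      rw [mainLoop_succ_nil hc]
      refine ⟨fun u hu => hu, h.bound, fun u hu => hD u ?_⟩
      have := (h.split u).1 hu
      rw [hc] at this
      simpa using this
    | cons u rest =>
      rw [mainLoop_succ_cons hc]
      have hua : u ∈ c.agenda := by rw [hc]; exact List.mem_cons_self
      have huf : u ∈ c.found := (h.split u).2 (Or.inr hua)
      obtain ⟨h1, h2⟩ := (h.pop hc).forEach_insertPath (hQ u (h.bound u huf))
      obtain ⟨e1, e2, e3⟩ := ih h1 (by
        intro v hv w hw
        rw [h2]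
        rcases Finset.mem_insert.1 hv with rfl | hv
        · exact Or.inl hw
        · exact Or.inr (hD v hv w hw)) (by
        rw [Finset.card_insert_of_notMem (h.fresh u hua)]
        omega)
      exact ⟨fun v hv => e1 v ((h2 v).2 (Or.inr hv)), e2, e3⟩

/-- The time of the search is bounded by the number of rounds and the number of links that leave
the paths not processed so far. -/
theorem StoreInv.time_mainLoop_le (hQ : ∀ u ∈ Q, ∀ w ∈ t u, w ∈ Q) {M : ℕ}
    (hM : ∀ u ∈ Q, u.length + 1 ≤ M) {n : ℕ} (h : StoreInv Q D c) :
    (XML.mainLoop t n c).time ≤ n * (M + 2) + 1 + (2 * M + 3) * linkCount (Q \ D) t := by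
  induction n generalizing c D with
  | zero =>
    show 1 + 0 ≤ _
    omega
  | succ n ih =>
    cases hc : c.agenda with
    | nil =>
      rw [mainLoop_succ_nil hc]
      show 1 ≤ _
      omega
    | cons u rest =>
      rw [mainLoop_succ_cons hc]
      have hua : u ∈ c.agenda := by rw [hc]; exact List.mem_cons_self
      have huQ : u ∈ Q := h.bound u ((h.split u).2 (Or.inr hua))
      obtain ⟨h1, -⟩ := (h.pop hc).forEach_insertPath (hQ u huQ)
      have e1 := ih h1
      have e2 := forEach_time_le (K := 2 * M + 2) (fun w hw c => le_trans (time_insertPath_le w c)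
        (by have := hM w (hQ u huQ w hw); omega)) { c with agenda := rest } (l := t u)
      have e3 : linkCount (Q \ D) t = linkCount (Q \ insert u D) t + (t u).length := by
        unfold linkCount
        rw [← Finset.sum_erase_add _ _ (Finset.mem_sdiff.2 ⟨huQ, h.fresh u hua⟩)]
        congr 2
        ext x
        simp only [Finset.mem_erase, Finset.mem_sdiff, Finset.mem_insert]
        tauto
      have e4 := hM u huQ
      rw [e3]
      simp only
      nlinarith

end Search

/-! ### The implementation -/

section Implementation

variable {E A : Type} [DecidableEq E] [DecidableEq A] {rt : E} {P : List (Path E A)}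
  {S : List (UnaryXFD E A)} {p : Path E A}

/-- The store before the main loop. -/
def initStore (rt : E) (p : Path E A) : Timed (Store E A) :=
  forEach insertPath [p, rootPath A rt] ⟨fun _ => false, [], []⟩

theorem storeInv_initStore {Q : Finset (Path E A)} (hp : p ∈ Q) (hr : rootPath A rt ∈ Q) :
    StoreInv Q ∅ (initStore rt p).val ∧
      ∀ x, x ∈ (initStore rt p).val.found ↔ x = p ∨ x = rootPath A rt := by
  have h0 : StoreInv Q ∅ (⟨fun _ => false, [], []⟩ : Store E A) :=
    ⟨by simp, by simp, List.nodup_nil, by simp, by simp⟩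
  obtain ⟨h1, h2⟩ := h0.forEach_insertPath (l := [p, rootPath A rt]) (by simp [hp, hr])
  exact ⟨h1, fun x => by rw [initStore, h2]; simp⟩

theorem computeClosure_val : (computeClosure rt P S p).val =
    (mainLoop (linkTable P S) P.length (initStore rt p).val).val.found := rfl

theorem computeClosure_time : (computeClosure rt P S p).time =
    (forEach indexPath P (fun _ => [])).time +
      ((forEach indexXFD S (forEach indexPath P (fun _ => [])).val).time +
        ((initStore rt p).time + (P.length +
          ((mainLoop (linkTable P S) P.length (initStore rt p).val).time + 0)))) := rfl

/-- The result of the implementation is closed under the rules, and it is contained in every closed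
set `X`, because the search stays within the members of `P` in `X`. -/
theorem RuleClosed.computeClosure (hin : IsInput rt P S p) {X : Set (Path E A)}
    (hX : RuleClosed rt P S p X) :
    (∀ u ∈ (XML.computeClosure rt P S p).val, u ∈ X) ∧
      RuleClosed rt P S p {u | u ∈ (XML.computeClosure rt P S p).val} := by
  classical
  have hmem : ∀ u, u ∈ P.toFinset.filter (· ∈ X) ↔ u ∈ P ∧ u ∈ X := by simp
  obtain ⟨h0, hf⟩ := storeInv_initStore (Q := P.toFinset.filter (· ∈ X))
    ((hmem p).2 ⟨hin.mem, hX.start⟩) ((hmem _).2 ⟨hin.pathSet.rootPath_mem hin.mem, hX.root⟩)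
  obtain ⟨e1, e2, e3⟩ := h0.mainLoop (t := linkTable P S) (n := P.length)
    (fun u hu w hw => by
      obtain ⟨hwP, hd⟩ := derives_of_mem_linkTable hin hw
      exact (hmem w).2 ⟨hwP, hX.step u ((hmem u).1 hu).2 w hwP hd⟩)
    (by simp)
    (le_trans (Finset.card_filter_le _ _) (le_trans (List.toFinset_card_le P) (Nat.le_add_right _ _)))
  rw [← computeClosure_val] at e1 e2 e3
  refine ⟨fun u hu => ((hmem u).1 (e2 u hu)).2, e1 p ((hf p).2 (Or.inl rfl)),
    e1 _ ((hf _).2 (Or.inr rfl)), ?_⟩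
  intro w hw u hu hd
  rcases mem_linkTable_of_derives hin ((hmem w).1 (e2 w hw)).1 hu hd with rfl | h
  · exact hw
  · exact e3 w hw u h

theorem computeClosure_time_le (hin : IsInput rt P S p) {L : ℕ} (hL : ∀ u ∈ P, u.length ≤ L) :
    (computeClosure rt P S p).time ≤ 50 * (L + 1) ^ 2 * (S.length + P.length + 1) := by
  have hM : ∀ u ∈ P, u.length + 1 ≤ L + 1 := fun u hu => Nat.succ_le_succ (hL u hu)
  have hroot := hin.pathSet.rootPath_mem hin.mem
  have hpos : 1 ≤ L + 1 := Nat.le_add_left 1 L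
  generalize L + 1 = M at hM hpos ⊢
  have t1 := forEach_time_le (fun u hu t => time_indexPath_le (hM u hu) t) (fun _ => [])
    (body := indexPath) (l := P)
  have t2 := forEach_time_le (fun σ hσ t => time_indexXFD_le (hM _ (hin.xfds σ hσ).1)
    (hM _ (hin.xfds σ hσ).2) t) (forEach indexPath P (fun _ => [])).val (body := indexXFD) (l := S)
  have t3 : (initStore rt p).time ≤ 2 * (2 * M + 2 + 1) + 1 := by
    refine forEach_time_le (l := [p, rootPath A rt]) (fun u hu c => ?_) _
    refine le_trans (time_insertPath_le u c) ?_
    have : u ∈ P := by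
      simp only [List.mem_cons, List.not_mem_nil, or_false] at hu
      rcases hu with rfl | rfl
      · exact hin.mem
      · exact hroot
    have := hM u this
    omega
  obtain ⟨h0, -⟩ := storeInv_initStore (Q := P.toFinset) (List.mem_toFinset.2 hin.mem)
    (List.mem_toFinset.2 hroot)
  have t4 := h0.time_mainLoop_le (t := linkTable P S) (n := P.length) (M := M)
    (fun u _ w hw => List.mem_toFinset.2 (derives_of_mem_linkTable hin hw).1)
    (fun u hu => hM u (List.mem_toFinset.1 hu))
  have t5 := Nat.mul_le_mul_left (2 * M + 3)
    (linkCount_linkTable_le hM hin.xfds (P.toFinset \ ∅))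
  rw [computeClosure_time]
  -- Every lower-order term is absorbed by `M * M`, since `1 ≤ M`.
  have m1 : M ≤ M * M := Nat.le_mul_of_pos_left M hpos
  have m2 : 1 ≤ M * M := hpos.trans m1
  have a1 := Nat.mul_le_mul_left P.length m1
  have a2 := Nat.mul_le_mul_left P.length m2
  have b1 := Nat.mul_le_mul_left S.length m1
  have b2 := Nat.mul_le_mul_left S.length m2
  nlinarith

omit [DecidableEq E] [DecidableEq A] in
/-- If `P` consists of prefixes of `p` and of the paths in the XFDs, its length is linear in the
number of XFDs. -/
theorem length_le_of_prefixes {L : ℕ} (hL : ∀ u ∈ P, u.length ≤ L) (hin : IsInput rt P S p)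
    (hP : P.Nodup) (hpre : ∀ u ∈ P, u <+: p ∨ ∃ σ ∈ S, u <+: σ.1 ∨ u <+: σ.2) :
    P.length ≤ (L + 1) * (2 * S.length + 1) := by
  have hsub : P ⊆ p.inits ++ S.flatMap fun σ => σ.1.inits ++ σ.2.inits := by
    intro u hu
    simpa [List.mem_inits] using hpre u hu
  refine le_trans (hP.subperm hsub).length_le ?_
  rw [List.length_append, List.length_inits, List.length_flatMap]
  have h1 := hL p hin.mem
  have h2 : (S.map fun σ => (σ.1.inits ++ σ.2.inits).length).sum ≤ S.length * (2 * (L + 1)) := by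
    rw [← List.length_map (as := S) fun σ : UnaryXFD E A => (σ.1.inits ++ σ.2.inits).length,
      ← smul_eq_mul]
    refine List.sum_le_card_nsmul _ _ fun n hn => ?_
    obtain ⟨σ, hσ, rfl⟩ := List.mem_map.1 hn
    have := hL _ (hin.xfds σ hσ).1
    have := hL _ (hin.xfds σ hσ).2
    rw [List.length_append, List.length_inits, List.length_inits]
    omega
  nlinarith

end Implementation

/-! ### Decidability of implication -/

section Decidability

open Primrec

/-- The list of all sublists is a primitive recursive function of the list. -/
theorem primrec_sublists' {α : Type} [Primcodable α] :
    Primrec (List.sublists' : List α → List (List α)) := by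
  have h : Primrec fun l : List α => l.foldr (fun a r => r ++ r.map (List.cons a)) [[]] :=
    list_foldr (h := fun (_ : List α) (x : α × List (List α)) => x.2 ++ x.2.map (List.cons x.1))
      Primrec.id (Primrec.const _) <| Primrec₂.mk <|
      list_append.comp (snd.comp snd) <|
        list_map (snd.comp snd) <| Primrec₂.mk <|
          list_cons.comp (fst.comp (snd.comp fst)) snd
  refine h.of_eq fun l => ?_
  induction l with
  | nil => rfl
  | cons a l ih => rw [List.foldr_cons, ih, List.sublists'_cons]

theorem primrecRel_prefix {α : Type} [Primcodable α] :
    PrimrecRel fun u w : List α => u <+: w :=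
  PrimrecRel.of_eq
    (Primrec.eq.comp₂ Primrec₂.left (list_take.comp₂ (list_length.comp₂ Primrec₂.left) Primrec₂.right))
    fun _ _ => List.prefix_iff_eq_take.symm

/-- Quantification over the members of a list that depends on the argument. -/
theorem primrecPred_forall_mem {α β : Type} [Primcodable α] [Primcodable β] {f : α → List β}
    {R : α → β → Prop} (hf : Primrec f) (hR : PrimrecRel R) :
    PrimrecPred fun a => ∀ b ∈ f a, R a b :=
  (PrimrecRel.forall_mem_list hR.swap).comp hf Primrec.id

theorem primrecPred_exists_mem {α β : Type} [Primcodable α] [Primcodable β] {f : α → List β}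
    {R : α → β → Prop} (hf : Primrec f) (hR : PrimrecRel R) :
    PrimrecPred fun a => ∃ b ∈ f a, R a b :=
  (PrimrecRel.exists_mem_list hR.swap).comp hf Primrec.id

theorem primrecPred_imp {α : Type} [Primcodable α] {p q : α → Prop} (hp : PrimrecPred p)
    (hq : PrimrecPred q) : PrimrecPred fun a => p a → q a := by
  classical exact (hp.not.or hq).of_eq fun _ => imp_iff_not_or.symm

theorem primrecRel_mem {α : Type} [Primcodable α] : PrimrecRel fun (a : α) (l : List α) => a ∈ l :=
  PrimrecRel.of_eq
    (primrecPred_exists_mem snd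
      (Primrec.eq.comp₂ (Primrec.fst.comp₂ Primrec₂.left) Primrec₂.right) :
      PrimrecPred fun x : α × List α => ∃ b ∈ x.2, x.1 = b).primrecRel
    fun a l => by simp

variable {E A : Type} [Primcodable E] [Primcodable A]

theorem primrec_isElem : Primrec (isElem : Label E A → Bool) :=
  (sumCasesOn Primrec.id (Primrec₂.const true) (Primrec₂.const false)).of_eq fun l => by
    rcases l with e | a | t <;> rfl

theorem primrec_isAttr : Primrec (isAttr : Label E A → Bool) :=
  (sumCasesOn Primrec.id (Primrec₂.const false)
    (sumCasesOn snd (Primrec₂.const true) (Primrec₂.const false)).to₂).of_eq fun l => by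
      rcases l with e | a | t <;> rfl

theorem primrec_getLast?_any {α : Type} [Primcodable α] {f : α → Bool} (hf : Primrec f) :
    Primrec fun l : List α => l.getLast?.any f :=
  (option_casesOn (list_head?.comp list_reverse) (Primrec.const false)
    (hf.comp₂ Primrec₂.right)).of_eq fun l => by
      rw [List.head?_reverse]
      cases l.getLast? <;> rfl

theorem primrecPred_lastIsElem : PrimrecPred fun u : Path E A => lastIsElem u = true :=
  Primrec.eq.comp (primrec_getLast?_any primrec_isElem) (Primrec.const true)

theorem primrecPred_lastIsAttr : PrimrecPred fun u : Path E A => lastIsAttr u = true :=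
  Primrec.eq.comp (primrec_getLast?_any primrec_isAttr) (Primrec.const true)

variable [DecidableEq E] [DecidableEq A]

omit [Primcodable E] [Primcodable A] in
theorem inter_prefix_iff {r s w : Path E A} : inter r s <+: w ↔
    ∀ n ∈ List.range (r.length + 1), r.take n <+: s → r.take n <+: w := by
  constructor
  · intro h n _ hs
    exact (prefix_inter (List.take_prefix n r) hs).trans h
  · intro h
    rw [← take_length_inter_left r s]
    refine h _ (List.mem_range.2 (Nat.lt_succ_of_le (length_inter_le_left r s))) ?_
    rw [take_length_inter_left]
    exact inter_prefix_right r s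

theorem primrecPred_inter_prefix : PrimrecPred fun x : UnaryXFD E A × Path E A =>
    inter x.1.1 x.1.2 <+: x.2 := by
  have htake : Primrec fun y : (UnaryXFD E A × Path E A) × ℕ => y.1.1.1.take y.2 :=
    list_take.comp snd (fst.comp (fst.comp fst))
  have h : PrimrecPred fun y : (UnaryXFD E A × Path E A) × ℕ =>
      y.1.1.1.take y.2 <+: y.1.1.2 → y.1.1.1.take y.2 <+: y.1.2 :=
    primrecPred_imp (primrecRel_prefix.comp htake (snd.comp (fst.comp fst)))
      (primrecRel_prefix.comp htake (snd.comp fst))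
  exact (primrecPred_forall_mem
    (R := fun (x : UnaryXFD E A × Path E A) n => x.1.1.take n <+: x.1.2 → x.1.1.take n <+: x.2)
    (list_range.comp (Primrec.succ.comp (list_length.comp (fst.comp fst))))
    h.primrecRel).of_eq fun x => inter_prefix_iff.symm

theorem primrecPred_derives : PrimrecPred fun x : List (UnaryXFD E A) × Path E A × Path E A =>
    Derives x.1 x.2.1 x.2.2 := by
  have hw : Primrec fun x : List (UnaryXFD E A) × Path E A × Path E A => x.2.1 := fst.comp snd
  have hu : Primrec fun x : List (UnaryXFD E A) × Path E A × Path E A => x.2.2 := snd.comp snd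
  have h1 : PrimrecPred fun x : List (UnaryXFD E A) × Path E A × Path E A =>
      lastIsElem x.2.1 = true ∧ x.2.2 <+: x.2.1 :=
    (primrecPred_lastIsElem.comp hw).and (primrecRel_prefix.comp hu hw)
  have h2 : PrimrecPred fun x : List (UnaryXFD E A) × Path E A × Path E A =>
      lastIsAttr x.2.2 = true ∧ x.2.2.dropLast = x.2.1 := by
    refine (primrecPred_lastIsAttr.comp hu).and ?_
    simp only [List.dropLast_eq_take]
    exact Primrec.eq.comp (list_take.comp (Primrec.pred.comp (list_length.comp hu)) hu) hw
  have h3 : PrimrecPred fun y : (List (UnaryXFD E A) × Path E A × Path E A) × UnaryXFD E A =>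
      y.2.2 = y.1.2.2 ∧ inter y.2.1 y.2.2 <+: y.1.2.1 ∧
        (y.1.2.1 <+: y.2.1 ∨ y.1.2.1 <+: y.2.2) :=
    (Primrec.eq.comp (snd.comp snd) (hu.comp fst)).and <|
      (primrecPred_inter_prefix.comp (Primrec.pair snd (hw.comp fst))).and <|
        (primrecRel_prefix.comp (hw.comp fst) (fst.comp snd)).or
          (primrecRel_prefix.comp (hw.comp fst) (snd.comp snd))
  exact h1.or (h2.or (primrecPred_exists_mem
    (R := fun (x : List (UnaryXFD E A) × Path E A × Path E A) (σ : UnaryXFD E A) =>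
      σ.2 = x.2.2 ∧ inter σ.1 σ.2 <+: x.2.1 ∧ (x.2.1 <+: σ.1 ∨ x.2.1 <+: σ.2))
    fst h3.primrecRel))

omit [Primcodable E] [Primcodable A] in
/-- Implication amounts to membership in all closed sublists of `P`, of which there are finitely
many. -/
theorem implies_iff_forall_sublists {rt : E} {P : List (Path E A)} {S : List (UnaryXFD E A)}
    {p q : Path E A} (hin : IsInput rt P S p) (hq : q ∈ P) :
    (∀ X ∈ P.sublists', (p ∈ X ∧ rootPath A rt ∈ X ∧
      ∀ w ∈ X, ∀ u ∈ P, Derives S w u → u ∈ X) → q ∈ X) ↔ Implies rt P S p q := by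
  classical
  constructor
  · intro h
    have hI := ruleClosed_implies hin
    have hmem : ∀ u, u ∈ P.filter (fun u => Implies rt P S p u) ↔ u ∈ P ∧ Implies rt P S p u := by
      simp
    refine ((hmem q).1 (h _ (List.mem_sublists'.2 List.filter_sublist)
      ⟨(hmem p).2 hI.start, (hmem _).2 hI.root, fun w hw u hu hd => ?_⟩)).2
    exact (hmem u).2 (hI.step w ((hmem w).1 hw) u hu hd)
  · rintro h X - ⟨h1, h2, h3⟩
    exact RuleClosed.mem_of_implies (X := {u | u ∈ X}) ⟨h1, h2, h3⟩ hin hq h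

theorem exists_computable_implies (rt : E) :
    ∃ f : List (Path E A) × List (UnaryXFD E A) × Path E A × Path E A → Bool, Computable f ∧
      ∀ (P : List (Path E A)) (S : List (UnaryXFD E A)) (p q : Path E A), IsInput rt P S p →
        q ∈ P → (f (P, S, p, q) = true ↔ Implies rt P S p q) := by
  classical
  -- `y.1` is the input and `y.2` the candidate for a closed set.
  have h1 : PrimrecPred fun z : (((List (Path E A) × List (UnaryXFD E A) × Path E A × Path E A) ×
      List (Path E A)) × Path E A) × Path E A =>
      Derives z.1.1.1.2.1 z.1.2 z.2 → z.2 ∈ z.1.1.2 :=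
    primrecPred_imp
      (primrecPred_derives.comp (Primrec.pair (fst.comp (snd.comp (fst.comp (fst.comp fst))))
        (Primrec.pair (snd.comp fst) snd)))
      (primrecRel_mem.comp snd (snd.comp (fst.comp fst)))
  have h2 : PrimrecPred fun z : ((List (Path E A) × List (UnaryXFD E A) × Path E A × Path E A) ×
      List (Path E A)) × Path E A =>
      ∀ u ∈ z.1.1.1, Derives z.1.1.2.1 z.2 u → u ∈ z.1.2 :=
    primrecPred_forall_mem
      (R := fun (z : ((List (Path E A) × List (UnaryXFD E A) × Path E A × Path E A) ×
        List (Path E A)) × Path E A) u => Derives z.1.1.2.1 z.2 u → u ∈ z.1.2)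
      (fst.comp (fst.comp fst)) h1.primrecRel
  have h3 : PrimrecPred fun y : (List (Path E A) × List (UnaryXFD E A) × Path E A × Path E A) ×
      List (Path E A) => ∀ w ∈ y.2, ∀ u ∈ y.1.1, Derives y.1.2.1 w u → u ∈ y.2 :=
    primrecPred_forall_mem
      (R := fun (y : (List (Path E A) × List (UnaryXFD E A) × Path E A × Path E A) ×
        List (Path E A)) w => ∀ u ∈ y.1.1, Derives y.1.2.1 w u → u ∈ y.2)
      snd h2.primrecRel
  have h4 : PrimrecPred fun y : (List (Path E A) × List (UnaryXFD E A) × Path E A × Path E A) ×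
      List (Path E A) => (y.1.2.2.1 ∈ y.2 ∧ rootPath A rt ∈ y.2 ∧
        ∀ w ∈ y.2, ∀ u ∈ y.1.1, Derives y.1.2.1 w u → u ∈ y.2) → y.1.2.2.2 ∈ y.2 :=
    primrecPred_imp
      ((primrecRel_mem.comp (fst.comp (snd.comp (snd.comp fst))) snd).and
        ((primrecRel_mem.comp (Primrec.const _) snd).and h3))
      (primrecRel_mem.comp (snd.comp (snd.comp (snd.comp fst))) snd)
  have h5 := primrecPred_forall_mem
    (R := fun (x : List (Path E A) × List (UnaryXFD E A) × Path E A × Path E A) X =>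
      (x.2.2.1 ∈ X ∧ rootPath A rt ∈ X ∧
        ∀ w ∈ X, ∀ u ∈ x.1, Derives x.2.1 w u → u ∈ X) → x.2.2.2 ∈ X)
    (primrec_sublists'.comp fst) h4.primrecRel
  refine ⟨_, h5.decide.to_comp, fun P S p q hin hq => ?_⟩
  rw [decide_eq_true_iff]
  exact implies_iff_forall_sublists hin hq

end Decidability

end XML

theorem mainTheorem2 {E A : Type} [DecidableEq E] [DecidableEq A] [Primcodable E] [Primcodable A]
    (rt : E) :
    (∀ (P : List (XML.Path E A)) (S : List (XML.UnaryXFD E A)) (p : XML.Path E A),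
      XML.IsInput rt P S p →
      -- every run uses each XFD at most once, and the runs reach a state where the loop stops
      (∀ n c, XML.Run rt P n (XML.initState rt P S p) c → n ≤ S.toFinset.card) ∧
      (∃ n c, XML.Run rt P n (XML.initState rt P S p) c ∧ XML.Final rt P c) ∧
      -- whatever choices are made, the set returned is the closure of `p`
      (∀ n c, XML.Run rt P n (XML.initState rt P S p) c → XML.Final rt P c →
        ∀ q, q ∈ c.closure ↔ q ∈ P ∧ XML.Implies rt P S p q) ∧
      -- the implementation returns the closure of `p`, in linear time
      (∀ q, q ∈ (XML.computeClosure rt P S p).val ↔ q ∈ P ∧ XML.Implies rt P S p q) ∧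
      (∀ L : ℕ, (∀ u ∈ P, u.length ≤ L) →
        (XML.computeClosure rt P S p).time ≤ 100 * (L + 1) ^ 2 * (S.length + P.length + 1) ∧
        -- if `P` has no repetitions and only the prefixes of `p` and of the paths in the XFDs
        (P.Nodup → (∀ u ∈ P, u <+: p ∨ ∃ σ ∈ S, u <+: σ.1 ∨ u <+: σ.2) →
          (XML.computeClosure rt P S p).time ≤ 200 * (L + 1) ^ 3 * (S.length + 1)))) ∧
    -- implication is decidable
    (∃ f : List (XML.Path E A) × List (XML.UnaryXFD E A) × XML.Path E A × XML.Path E A → Bool,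
      Computable f ∧
      ∀ (P : List (XML.Path E A)) (S : List (XML.UnaryXFD E A)) (p q : XML.Path E A),
        XML.IsInput rt P S p → q ∈ P → (f (P, S, p, q) = true ↔ XML.Implies rt P S p q)) := by
  refine ⟨fun P S p hin => ⟨?_, (XML.Run.refl _).exists_final, ?_, ?_, ?_⟩,
    XML.exists_computable_implies rt⟩
  · intro n c h
    have hcard : n + c.unused.card = S.toFinset.card := h.card_unused
    omega
  · intro n c h hf
    have hr := h.reached hin
    exact (hr.ruleClosed hin hf).mem_iff_of_least hin hr.least
  · exact ((XML.ruleClosed_implies hin).computeClosure hin).2.mem_iff_of_least hin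
      fun _ hY => (hY.computeClosure hin).1
  · intro L hL
    have h := XML.computeClosure_time_le hin hL
    refine ⟨h.trans ?_, fun hnd hpre => h.trans ?_⟩
    · exact Nat.mul_le_mul_right _ (Nat.mul_le_mul_right _ (by norm_num))
    · have hlen := XML.length_le_of_prefixes hL hin hnd hpre
      calc 50 * (L + 1) ^ 2 * (S.length + P.length + 1)
          ≤ 50 * (L + 1) ^ 2 * (4 * (L + 1) * (S.length + 1)) :=
            Nat.mul_le_mul_left _ (by nlinarith)
        _ = 200 * (L + 1) ^ 3 * (S.length + 1) := by ring
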